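/- **Setting.** There are $n\ge 1$ bidders and $k\ge 1$ items. A valuation profile is $v=(v_{ij})$ with $v_{ij}\ge 0$; valuations are additive. A single good is sold to bidders with values $b_1,\dots,b_n$ at prices $q_1,\dots,q_n\ge 0$ by one of two rules. *Posted prices*: among the bidders with $b_i\ge q_i$, one with the highest price $q_i$ gets the good and pays $q_i$ (prices are offered in decreasing order). *Second price with reserves*: the highest bidder $i$ gets the good if $b_i\ge q_i$, and pays $\max(q_i,\max_{i'\neq i}b_{i'})$. Ties go to the lowest index. *Grand-bundle pricing* sells all items together, as one good with $b_i=\sum_j v_{ij}$ and prices $p_i$; *item pricing* sells each item $j$ separately, with $b_i=v_{ij}$ and prices $p_{ij}$. In the *anonymous* versions the prices do not depend on $i$. *Best of both* is the union of the grand-bundle class and the item class (both anonymous or both non-anonymous). Write $r(h,v)$ for the revenue (sum of payments) of auction $h$ on profile $v$, and $R_D(h)=\mathbb E_{v\sim D}[r(h,v)]$. An auction is identified with its prices. An *ERM process* for a class $H$ maps every non-empty finite sample $T$ (a multiset of profiles) to some $h_T\in H$ that maximizes $\frac1{|T|}\sum_{v\in T}r(h,v)$ over $h\in H$; ties are broken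 by a fixed rule which favors prices that are sample values: anonymous bundle prices of the form $\sum_j v_{ij}$ with $v\in T$ and some bidder $i$; non-anonymous bundle prices $p_i=\sum_j v_{ij}$ with $v\in T$; anonymous item prices $p_j=v_{ij}$ with $v\in T$ and some $i$; non-anonymous item prices $p_{ij}=v_{ij}$ with $v\in T$. Its *split-sample growth rate* is $$\hat\tau_H(m)=\sup_{|S|=m}\bigl|\{h_T: T\subseteq S,\ |T|=\lceil m/2\rceil\}\bigr|.$$ Its *sample complexity* $m_H(\epsilon)$ is the smallest $m_0$ such that for all $m\ge m_0$ and all distributions $D$ on profiles for which the revenue of every auction of $H$ lies in $[0,1]$, $\mathbb E_{S\sim D^m}[R_D(h_S)]\ge\sup_{h\in H}R_D(h)-\epsilon$. **Theorem.** For either rule of sale: 1. In each of the six classes, on every non-empty sample some empirical revenue maximizer has all its prices among the sample values, and hence so does the output of every ERM process. 2. For every ERM process and all $m\ge 1$: $\hat\tau_H(m)\le mn$ (anonymous grand bundle), $m^n$ (non-anonymous grand bundle), $(nm)^k$ (anonymous item pricing), $m^{nk}$ (non-anonymous item pricing), $(mn)^{k+1}$ (anonymous best of both), $m^{n(k+1)}$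 (non-anonymous best of both). 3. There is a universal constant $C$ such that for all $n,k\ge1$, $0<\epsilon\le 1/2$ and every ERM process, $m_H(\epsilon)$ is at most $C\,\frac{n\log(1/\epsilon)}{\epsilon^2}$ for grand-bundle pricing, $C\,\frac{nk\log(1/\epsilon)}{\epsilon^2}$ for item pricing, and $C\,\frac{n(k+1)\log(1/\epsilon)}{\epsilon^2}$ for best of both, each in the anonymous and in the non-anonymous version. 4. Let $n=1$, let $H$ be a best-of-both class and let $D$ be a distribution with independent item values for which the revenue of every auction of $H$ lies in $[0,1]$. Then for every ERM process for $H$ and all $m\ge1$, $$\mathbb E_{S\sim D^m}[R_D(h_S)]\ \ge\ \frac16\sup_{M}R_D(M)-\sqrt{\frac{2(k+1)\log(2m)}{m}},$$ where $M$ ranges over all truthful (incentive compatible and individually rational, possibly randomized) mechanisms. -/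

import Mathlib

open MeasureTheory ProbabilityTheory
open scoped NNReal ENNReal

namespace SplitSample

noncomputable section

/-! ### Mechanisms for `n` additive bidders and `k` items -/

/-- A valuation profile: `v i j` is the value of bidder `i` for item `j`. -/
abbrev Profile (n k : ℕ) : Type := Fin n → Fin k → ℝ≥0

/-- A direct (possibly randomized) mechanism: on reports `v`, bidder `i` receives item `j` with
probability `alloc v i j` and pays `pay v i` (in expectation over the mechanism's coins). -/
structure Mechanism (n k : ℕ) where
  alloc : Profile n k → Fin n → Fin k → ℝ
  pay : Profile n k → Fin n → ℝ

namespace Mechanism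

variable {n k : ℕ}

/-- Revenue on a profile: the sum of the payments. -/
def revenue (M : Mechanism n k) (v : Profile n k) : ℝ := ∑ i, M.pay v i

/-- Expected revenue under the value distribution `D`. -/
def expRevenue (M : Mechanism n k) (D : Measure (Profile n k)) : ℝ := ∫ v, M.revenue v ∂D

/-- Utility of bidder `i` with (additive) item values `w` when the reported profile is `v`. -/
def utility (M : Mechanism n k) (i : Fin n) (w : Fin k → ℝ≥0) (v : Profile n k) : ℝ :=
  ∑ j, (w j : ℝ) * M.alloc v i j - M.pay v i

/-- Dominant-strategy truthful mechanisms: every item is allocated at most once, no bidder ever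
gains by misreporting, and truthful participation never gives negative utility. -/
structure IsTruthful (M : Mechanism n k) : Prop where
  alloc_nonneg : ∀ v i j, 0 ≤ M.alloc v i j
  alloc_le_one : ∀ v j, ∑ i, M.alloc v i j ≤ 1
  incentive_compatible : ∀ (v : Profile n k) (i : Fin n) (w' : Fin k → ℝ≥0),
    M.utility i (v i) (Function.update v i w') ≤ M.utility i (v i) v
  individually_rational : ∀ (v : Profile n k) (i : Fin n), 0 ≤ M.utility i (v i) v

end Mechanism

/-! ### Selling one good with a price (reserve) for each bidder -/

/-- How one good (an item or the grand bundle) is sold, given a price for each bidder.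
`postedPrice`: take-it-or-leave-it prices, offered in decreasing order of price.
`secondPrice`: second-price auction in which the prices are (bidder-specific) reserves. -/
inductive SaleRule
  | postedPrice
  | secondPrice

variable {n k : ℕ}

/-- Bidder `i` gets the good, at prices `q` and bids `b`. Under both rules `i` must meet her own
price; she must moreover have the highest price among the bidders who meet theirs (posted prices),
or the highest bid (second-price auction). Ties go to the lowest index. -/
def SaleRule.wins (rule : SaleRule) (q b : Fin n → ℝ≥0) (i : Fin n) : Prop :=
  match rule with
  | .postedPrice => q i ≤ b i ∧ ∀ i', q i' ≤ b i' → q i' < q i ∨ (q i' = q i ∧ i ≤ i')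
  | .secondPrice => q i ≤ b i ∧ ∀ i', b i' < b i ∨ (b i' = b i ∧ i ≤ i')

/-- What bidder `i` pays when she gets the good: her price, respectively the larger of her price
and the highest competing bid. -/
def SaleRule.charge (rule : SaleRule) (q b : Fin n → ℝ≥0) (i : Fin n) : ℝ≥0 :=
  match rule with
  | .postedPrice => q i
  | .secondPrice => max (q i) ((Finset.univ.erase i).sup b)

open Classical in
/-- Sell all items as one grand bundle; `q i` is the price of the bundle for bidder `i`. -/
def bundleMechanism (rule : SaleRule) (q : Fin n → ℝ≥0) : Mechanism n k where
  alloc v i _ := if rule.wins q (fun i' => ∑ j, v i' j) i then 1 else 0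
  pay v i := if rule.wins q (fun i' => ∑ j, v i' j) i then
    (rule.charge q (fun i' => ∑ j, v i' j) i : ℝ) else 0

open Classical in
/-- Sell every item separately; `q i j` is the price of item `j` for bidder `i`. -/
def itemMechanism (rule : SaleRule) (q : Fin n → Fin k → ℝ≥0) : Mechanism n k where
  alloc v i j := if rule.wins (fun i' => q i' j) (fun i' => v i' j) i then 1 else 0
  pay v i := ∑ j, if rule.wins (fun i' => q i' j) (fun i' => v i' j) i then
    (rule.charge (fun i' => q i' j) (fun i' => v i' j) i : ℝ) else 0

/-! ### Parametrized auction classes -/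

/-- A parametrized class of auctions, together with, for every sample `T`, the set of those
parameters whose prices are values that occur in `T`. -/
structure AuctionClass (n k : ℕ) where
  Hyp : Type
  mech : Hyp → Mechanism n k
  onSample : Multiset (Profile n k) → Set Hyp

/-- Grand-bundle pricing with one price for all bidders. -/
def anonymousBundlePricing (rule : SaleRule) (n k : ℕ) : AuctionClass n k where
  Hyp := ℝ≥0
  mech p := bundleMechanism rule (fun _ => p)
  onSample T := {p | ∃ v ∈ T, ∃ i, p = ∑ j, v i j}

/-- Grand-bundle pricing with a price for each bidder. -/
def bundlePricing (rule : SaleRule) (n k : ℕ) : AuctionClass n k where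
  Hyp := Fin n → ℝ≥0
  mech p := bundleMechanism rule p
  onSample T := {p | ∀ i, ∃ v ∈ T, p i = ∑ j, v i j}

/-- Item pricing with one price per item for all bidders. -/
def anonymousItemPricing (rule : SaleRule) (n k : ℕ) : AuctionClass n k where
  Hyp := Fin k → ℝ≥0
  mech p := itemMechanism rule (fun _ => p)
  onSample T := {p | ∀ j, ∃ v ∈ T, ∃ i, p j = v i j}

/-- Item pricing with a price for each bidder and item. -/
def itemPricing (rule : SaleRule) (n k : ℕ) : AuctionClass n k where
  Hyp := Fin n → Fin k → ℝ≥0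
  mech p := itemMechanism rule p
  onSample T := {p | ∀ i j, ∃ v ∈ T, p i j = v i j}

/-- The union of two classes: use an auction of the one or of the other. -/
def bestOf (A B : AuctionClass n k) : AuctionClass n k where
  Hyp := A.Hyp ⊕ B.Hyp
  mech := Sum.elim A.mech B.mech
  onSample T := Sum.inl '' A.onSample T ∪ Sum.inr '' B.onSample T

/-- Best of anonymous grand-bundle pricing and anonymous item pricing. -/
def anonymousBestPricing (rule : SaleRule) (n k : ℕ) : AuctionClass n k :=
  bestOf (anonymousBundlePricing rule n k) (anonymousItemPricing rule n k)

/-- Best of non-anonymous grand-bundle pricing and non-anonymous item pricing. -/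
def bestPricing (rule : SaleRule) (n k : ℕ) : AuctionClass n k :=
  bestOf (bundlePricing rule n k) (itemPricing rule n k)

/-! ### Empirical revenue maximization, split-sample growth, sample complexity -/

/-- The split-sample hypothesis space of a sample `S`: the outputs of the process `erm` on the
sub-samples of `S` of size `⌈|S| / 2⌉`. Samples are finite multisets. -/
def splitSampleSpace {Z H : Type} (erm : Multiset Z → H) (S : Multiset Z) : Set H :=
  {h | ∃ T ≤ S, T.card = (S.card + 1) / 2 ∧ h = erm T}

/-- The split-sample growth rate at `m`. -/
def splitSampleGrowth {Z H : Type} (erm : Multiset Z → H) (m : ℕ) : ℕ∞ :=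
  ⨆ (S : Multiset Z) (_ : S.card = m), (splitSampleSpace erm S).encard

namespace AuctionClass

/-- Average revenue on the sample `T`. -/
def empRevenue (A : AuctionClass n k) (T : Multiset (Profile n k)) (h : A.Hyp) : ℝ :=
  (T.map (fun v => (A.mech h).revenue v)).sum / T.card

/-- `h` maximizes the empirical revenue on `T` over the class. -/
def IsMaximizer (A : AuctionClass n k) (T : Multiset (Profile n k)) (h : A.Hyp) : Prop :=
  ∀ h', A.empRevenue T h' ≤ A.empRevenue T h

/-- Empirical revenue maximization with a fixed rule that breaks ties in favour of prices that are
values in the sample (if there are such prices among the maximizers). -/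
structure IsERM (A : AuctionClass n k) (erm : Multiset (Profile n k) → A.Hyp) : Prop where
  isMaximizer : ∀ T ≠ 0, A.IsMaximizer T (erm T)
  favors_sample : ∀ T ≠ 0, (∃ h ∈ A.onSample T, A.IsMaximizer T h) → erm T ∈ A.onSample T

/-- Best expected revenue of the class under `D`. -/
def optRevenue (A : AuctionClass n k) (D : Measure (Profile n k)) : ℝ :=
  ⨆ h : A.Hyp, (A.mech h).expRevenue D

/-- Expected revenue under `D` of the auction that `erm` picks from `m` independent draws from `D`.
The integrand is nonnegative; `∫⁻` is the lower integral, so that lower bounds on this quantity are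
meaningful without measurability of the tie-breaking, and it is the expectation when the integrand
is measurable. -/
def learnedRevenue (A : AuctionClass n k) (erm : Multiset (Profile n k) → A.Hyp)
    (D : Measure (Profile n k)) (m : ℕ) : ℝ≥0∞ :=
  ∫⁻ s : Fin m → Profile n k,
    ENNReal.ofReal ((A.mech (erm (Finset.univ.val.map s))).expRevenue D) ∂Measure.pi (fun _ => D)

/-- The distributions for which the revenue of every auction of the class lies in `[0, 1]`. -/
def unitRevenue (A : AuctionClass n k) : Set (ProbabilityMeasure (Profile n k)) :=
  {D | ∀ᵐ v ∂(D : Measure (Profile n k)), ∀ h : A.Hyp, (A.mech h).revenue v ∈ Set.Icc 0 1}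

/-- Additive-error sample complexity of the class with the learning rule `erm`, over a set `𝒟` of
distributions: the smallest `m₀` such that, for all `m ≥ m₀` and all `D ∈ 𝒟`, `m` samples suffice
for expected revenue within `ε` of the best in the class (`⊤` if there is no such `m₀`). -/
def sampleComplexity (A : AuctionClass n k) (erm : Multiset (Profile n k) → A.Hyp)
    (𝒟 : Set (ProbabilityMeasure (Profile n k))) (ε : ℝ) : ℕ∞ :=
  sInf {x | ∃ m₀ : ℕ, x = m₀ ∧ ∀ m ≥ m₀, ∀ D ∈ 𝒟,
    ENNReal.ofReal (A.optRevenue D) ≤ A.learnedRevenue erm D m + ENNReal.ofReal ε}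

/-- Some empirical revenue maximizer has all its prices among the sample values, hence so does
every output of an ERM process that favours sample values. -/
def ERMOnSample (A : AuctionClass n k) : Prop :=
  (∀ T ≠ 0, ∃ h ∈ A.onSample T, A.IsMaximizer T h) ∧
    ∀ erm, A.IsERM erm → ∀ T ≠ 0, erm T ∈ A.onSample T

/-- The split-sample growth rate of every ERM process at `m` is at most `B`. -/
def GrowthLE (A : AuctionClass n k) (m B : ℕ) : Prop :=
  ∀ erm, A.IsERM erm → splitSampleGrowth erm m ≤ B

/-- The sample complexity of every ERM process at accuracy `ε`, over all distributions with
revenues in `[0, 1]`, is at most `B`. -/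
def ComplexityLE (A : AuctionClass n k) (ε B : ℝ) : Prop :=
  ∀ erm, A.IsERM erm → (A.sampleComplexity erm A.unitRevenue ε : ℝ≥0∞) ≤ ENNReal.ofReal B

end AuctionClass

end

end SplitSample

/-!
Rounding every price up to the nearest value in the sample loses nothing on the sample, so an
empirical revenue maximizer can be found among the prices that are sample values. Counting those
prices bounds the split-sample growth.

For the sample complexity, symmetrization with a ghost sample bounds the expected deviation by
averages over random signs. The crude bound through the growth rate would cost a factor `log m`;
instead the revenue of one good is written as an integral over its level sets. Whether the revenue
reaches a given level is decided by `n` comparisons between prices and bids, so the level sets have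
VC dimension at most `2 n` and their random signed sums are small, uniformly in the number of goods
because the values of all goods together add up to at most `1`.

For one bidder with independent values, a payment is bounded by what the favorite good contributes,
which posted item prices collect, and by the values of the other goods. Let `R` be the sum of the
best revenues from posting a price for each item. The values of the other goods that reach `R` are
again paid for by item prices. The values below `R` have a total of variance at most `2 R ^ 2`, so
the total concentrates around its mean and a bundle price collects it.
-/

namespace SplitSample

open Finset
open scoped BigOperators

noncomputable section

/-! ### Maxima of random signed sums -/

section Signs

variable {ι : Type*} [Fintype ι]

/-- The sum of `a` with signs `σ`. Rademacher averages are averages `𝔼 σ, _` over all signs. -/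
def signedSum (σ : ι → ℤˣ) : (ι → ℝ) →ₗ[ℝ] ℝ :=
  ∑ t, ((σ t : ℤ) : ℝ) • LinearMap.proj t

theorem signedSum_apply (σ : ι → ℤˣ) (a : ι → ℝ) : signedSum σ a = ∑ t, ((σ t : ℤ) : ℝ) * a t := by
  simp [signedSum]

theorem signedSum_neg (σ : ι → ℤˣ) (a : ι → ℝ) : signedSum (-σ) a = -signedSum σ a := by
  simp [signedSum_apply]

variable [DecidableEq ι]

theorem expect_exp_signedSum_le (a : ι → ℝ) :
    𝔼 σ, Real.exp (signedSum σ a) ≤ Real.exp ((∑ t, a t ^ 2) / 2) := by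
  have cosh_eq (x : ℝ) : ∑ s : ℤˣ, Real.exp (((s : ℤ) : ℝ) * x) = 2 * Real.cosh x := by
    rw [UnitsInt.univ, sum_pair (by decide), Real.cosh_eq]
    norm_num
    ring
  have prod_cosh : ∑ σ, Real.exp (signedSum σ a) = 2 ^ Fintype.card ι * ∏ t, Real.cosh (a t) := by
    simp only [signedSum_apply, Real.exp_sum]
    rw [← Fintype.piFinset_univ, ← prod_univ_sum (fun _ => univ) fun t (s : ℤˣ) =>
      Real.exp (((s : ℤ) : ℝ) * a t)]
    simp only [cosh_eq, prod_mul_distrib, prod_const, card_univ]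
  calc 𝔼 σ, Real.exp (signedSum σ a) = ∏ t, Real.cosh (a t) := by
        rw [Fintype.expect_eq_sum_div_card, prod_cosh, Fintype.card_fun, Fintype.card_units_int]
        simp
    _ ≤ ∏ t, Real.exp (a t ^ 2 / 2) :=
        prod_le_prod (fun t _ => (Real.cosh_pos _).le) fun t _ => Real.cosh_le_exp_half_sq _
    _ = Real.exp ((∑ t, a t ^ 2) / 2) := by rw [sum_div, Real.exp_sum]

theorem expect_le_of_expect_exp_le {α : Type*} [Fintype α] [Nonempty α] {X : α → ℝ} {L : ℝ}
    (h : 𝔼 i, Real.exp (X i) ≤ Real.exp L) : 𝔼 i, X i ≤ L := by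
  have tangent (i : α) : X i ≤ Real.exp (-L) * Real.exp (X i) + (L - 1) := by
    have := Real.add_one_le_exp (-L + X i)
    rw [Real.exp_add] at this
    linarith
  calc 𝔼 i, X i ≤ 𝔼 i, (Real.exp (-L) * Real.exp (X i) + (L - 1)) :=
        expect_le_expect fun i _ => tangent i
    _ = Real.exp (-L) * 𝔼 i, Real.exp (X i) + (L - 1) := by
        rw [expect_add_distrib, ← mul_expect, Fintype.expect_const]
    _ ≤ Real.exp (-L) * Real.exp L + (L - 1) := by gcongr
    _ = L := by rw [← Real.exp_add]; simp

/-- **Massart's lemma**; the optimal scale is `c = √(2 K / W)`. -/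
theorem expect_signedSum_le_of_card_le_exp (V : Finset (ι → ℝ)) {K W c : ℝ}
    (hK : (#V : ℝ) ≤ Real.exp K) (hW : ∀ a ∈ V, ∑ t, a t ^ 2 ≤ W) (hc : 0 < c)
    (a : (ι → ℤˣ) → ι → ℝ) (ha : ∀ σ, a σ ∈ V) :
    𝔼 σ, signedSum σ (a σ) ≤ (K + c ^ 2 * W / 2) / c := by
  have exp_le (b : ι → ℝ) (hb : b ∈ V) :
      𝔼 σ, Real.exp (signedSum σ (c • b)) ≤ Real.exp (c ^ 2 * W / 2) := by
    refine (expect_exp_signedSum_le _).trans ?_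
    simp only [Pi.smul_apply, smul_eq_mul, mul_pow, ← mul_sum]
    gcongr
    exact hW b hb
  have exp_max_le : 𝔼 σ, Real.exp (signedSum σ (c • a σ)) ≤ Real.exp (K + c ^ 2 * W / 2) := by
    calc 𝔼 σ, Real.exp (signedSum σ (c • a σ))
        ≤ 𝔼 σ, ∑ b ∈ V, Real.exp (signedSum σ (c • b)) :=
          expect_le_expect fun σ _ => single_le_sum
            (f := fun b => Real.exp (signedSum σ (c • b))) (fun b _ => (Real.exp_pos _).le) (ha σ)
      _ = ∑ b ∈ V, 𝔼 σ, Real.exp (signedSum σ (c • b)) := expect_sum_comm _ _ _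
      _ ≤ #V * Real.exp (c ^ 2 * W / 2) := by
          simpa using sum_le_card_nsmul V _ _ exp_le
      _ ≤ Real.exp K * Real.exp (c ^ 2 * W / 2) := by gcongr
      _ = Real.exp (K + c ^ 2 * W / 2) := (Real.exp_add _ _).symm
  have := expect_le_of_expect_exp_le exp_max_le
  simp only [map_smul, smul_eq_mul, ← mul_expect] at this
  rwa [le_div_iff₀' hc]

end Signs

end

noncomputable section

/-! ### Symmetrization -/

section Symmetrization

theorem integral_comp_measurePreserving {X Y : Type*} [MeasurableSpace X] [MeasurableSpace Y]
    {μ : Measure X} {ν : Measure Y} {g : X → Y} (hg : MeasurePreserving g μ ν) {f : Y → ℝ}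
    (hf : AEStronglyMeasurable f ν) : ∫ x, f (g x) ∂μ = ∫ y, f y ∂ν := by
  rw [← hg.map_eq] at hf ⊢
  exact (integral_map hg.measurable.aemeasurable hf).symm

variable {ι Z : Type*}

/-- Exchange the two halves of the double sample `ω` at the negative signs. -/
def swapPairs (σ : ι → ℤˣ) (ω : ι → Z × Z) : ι → Z × Z :=
  fun t => if σ t = 1 then ω t else (ω t).swap

/-- The first half of a double sample; that of `swapPairs σ ω` is the sub-sample of `ω` that the
signs `σ` select. -/
def firstHalf (ω : ι → Z × Z) : ι → Z := fun t => (ω t).1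

variable [Fintype ι]

/-- How much larger the values of `f (firstHalf ω)` are on the first half of the double sample `ω`
than on the second half, in total. -/
def deviation (f : (ι → Z) → Z → ℝ) (ω : ι → Z × Z) : ℝ :=
  ∑ t, (f (firstHalf ω) (ω t).1 - f (firstHalf ω) (ω t).2)

theorem deviation_swapPairs (f : (ι → Z) → Z → ℝ) (σ : ι → ℤˣ) (ω : ι → Z × Z) :
    deviation f (swapPairs σ ω) = signedSum σ fun t =>
      f (firstHalf (swapPairs σ ω)) (ω t).1 - f (firstHalf (swapPairs σ ω)) (ω t).2 := by
  rw [deviation, signedSum_apply]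
  refine sum_congr rfl fun t _ => ?_
  generalize firstHalf (swapPairs σ ω) = s
  rcases Int.units_eq_one_or (σ t) with h | h <;> simp [swapPairs, h]

variable [MeasurableSpace Z] (D : Measure Z) [IsProbabilityMeasure D]

theorem measurePreserving_swapPairs (σ : ι → ℤˣ) :
    MeasurePreserving (swapPairs (Z := Z) σ) (Measure.pi fun _ => D.prod D)
      (Measure.pi fun _ => D.prod D) := by
  refine measurePreserving_pi (fun _ : ι => D.prod D) (fun _ : ι => D.prod D)
    (f := fun t p => if σ t = 1 then p else p.swap) fun t => ?_
  by_cases h : σ t = 1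
  · simp only [h, if_true]
    exact MeasurePreserving.id _
  · simpa only [h, if_false] using Measure.measurePreserving_swap (μ := D) (ν := D)

theorem measurePreserving_firstHalf :
    MeasurePreserving (firstHalf (ι := ι) (Z := Z)) (Measure.pi fun _ => D.prod D)
      (Measure.pi fun _ => D) :=
  measurePreserving_fst.comp
    (measurePreserving_arrowProdEquivProdArrow Z Z ι (fun _ => D) (fun _ => D))

theorem measurePreserving_firstHalf_snd (t : ι) :
    MeasurePreserving (fun ω : ι → Z × Z => (firstHalf ω, (ω t).2))
      (Measure.pi fun _ => D.prod D) ((Measure.pi fun _ => D).prod D) :=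
  ((MeasurePreserving.id _).prod (measurePreserving_eval (fun _ : ι => D) t)).comp
    (measurePreserving_arrowProdEquivProdArrow Z Z ι (fun _ => D) (fun _ => D))

variable {D} {f : (ι → Z) → Z → ℝ}
  (hf : Integrable (fun p : (ι → Z) × Z => f p.1 p.2) ((Measure.pi fun _ => D).prod D))
  (hfs : ∀ t, Integrable (fun s => f s (s t)) (Measure.pi fun _ : ι => D))

include hf hfs

theorem integrable_deviation : Integrable (deviation f) (Measure.pi fun _ => D.prod D) :=
  integrable_finsetSum _ fun t _ =>
    ((measurePreserving_firstHalf D).integrable_comp_of_integrable (hfs t)).sub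
      ((measurePreserving_firstHalf_snd D t).integrable_comp_of_integrable hf)

theorem integral_deviation :
    ∫ ω, deviation f ω ∂(Measure.pi fun _ => D.prod D) =
      ∫ s, ∑ t, f s (s t) ∂(Measure.pi fun _ => D) -
        Fintype.card ι * ∫ s, ∫ z, f s z ∂D ∂(Measure.pi fun _ => D) := by
  have hfst (t : ι) := integral_comp_measurePreserving (measurePreserving_firstHalf D)
    (hfs t).aestronglyMeasurable
  have hsnd (t : ι) := integral_comp_measurePreserving (measurePreserving_firstHalf_snd D t)
    hf.aestronglyMeasurable
  have hfst_int (t : ι) := (measurePreserving_firstHalf D).integrable_comp_of_integrable (hfs t)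
  have hsnd_int (t : ι) :=
    (measurePreserving_firstHalf_snd D t).integrable_comp_of_integrable hf
  calc ∫ ω, deviation f ω ∂(Measure.pi fun _ => D.prod D)
      = ∑ t, ∫ ω, (f (firstHalf ω) (ω t).1 - f (firstHalf ω) (ω t).2)
          ∂(Measure.pi fun _ => D.prod D) :=
        integral_finsetSum _ fun t _ => (hfst_int t).sub (hsnd_int t)
    _ = ∑ t, (∫ s, f s (s t) ∂(Measure.pi fun _ => D) -
          ∫ p, f p.1 p.2 ∂((Measure.pi fun _ => D).prod D)) :=
        sum_congr rfl fun t _ => (integral_sub (hfst_int t) (hsnd_int t)).trans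
          (congrArg₂ (· - ·) (hfst t) (hsnd t))
    _ = _ := by
        rw [sum_sub_distrib, integral_finsetSum _ fun t _ => hfs t, integral_prod _ hf,
          sum_const, nsmul_eq_mul, card_univ]

variable [DecidableEq ι]

/-- The double sample has the same distribution after swapping any of its pairs, so it suffices to
bound the deviation on average over all swaps of a fixed double sample. -/
theorem integral_sum_le_of_expect_deviation_le {β : ℝ}
    (hβ : ∀ᵐ ω ∂(Measure.pi fun _ => D.prod D), 𝔼 σ : ι → ℤˣ, deviation f (swapPairs σ ω) ≤ β) :
    ∫ s, ∑ t, f s (s t) ∂(Measure.pi fun _ => D) ≤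
      Fintype.card ι * ∫ s, ∫ z, f s z ∂D ∂(Measure.pi fun _ => D) + β := by
  have hdev := integrable_deviation hf hfs
  have hint (σ : ι → ℤˣ) :
      Integrable (fun ω => deviation f (swapPairs σ ω)) (Measure.pi fun _ => D.prod D) :=
    (measurePreserving_swapPairs D σ).integrable_comp_of_integrable hdev
  have hswap (σ : ι → ℤˣ) := integral_comp_measurePreserving (measurePreserving_swapPairs D σ)
    hdev.aestronglyMeasurable
  have hle : ∫ ω, deviation f ω ∂(Measure.pi fun _ => D.prod D) ≤ β := by
    calc ∫ ω, deviation f ω ∂(Measure.pi fun _ => D.prod D)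
        = 𝔼 σ : ι → ℤˣ, ∫ ω, deviation f (swapPairs σ ω) ∂(Measure.pi fun _ => D.prod D) := by
          simp only [hswap, Fintype.expect_const]
      _ = ∫ ω, 𝔼 σ : ι → ℤˣ, deviation f (swapPairs σ ω) ∂(Measure.pi fun _ => D.prod D) := by
          simp only [Fintype.expect_eq_sum_div_card, integral_div]
          rw [integral_finsetSum _ fun σ _ => hint σ]
      _ ≤ ∫ _, β ∂(Measure.pi fun _ => D.prod D) := by
          refine integral_mono_ae ?_ (integrable_const _) hβ
          simp only [Fintype.expect_eq_sum_div_card]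
          exact (integrable_finsetSum _ fun σ _ => hint σ).div_const _
      _ = β := by simp
  rw [integral_deviation hf hfs] at hle
  linarith

end Symmetrization

/-! ### Measurable selection -/

section Selection

variable {X Φ : Type*} [MeasurableSpace X] [MeasurableSpace Φ]

theorem exists_measurable_selection [Countable Φ] [Nonempty Φ] {E : Φ → Set X}
    (hE : ∀ φ, MeasurableSet (E φ)) (hcover : ∀ x, ∃ φ, x ∈ E φ) :
    ∃ sel : X → Φ, Measurable sel ∧ ∀ x, x ∈ E (sel x) := by
  classical
  obtain ⟨e, he⟩ := exists_surjective_nat Φ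
  have hex (x : X) : ∃ i, x ∈ E (e i) := by
    obtain ⟨φ, hφ⟩ := hcover x
    obtain ⟨i, rfl⟩ := he φ
    exact ⟨i, hφ⟩
  exact ⟨fun x => e (Nat.find (hex x)),
    (measurable_from_nat (f := e)).comp (measurable_find hex fun i => hE (e i)),
    fun x => Nat.find_spec (hex x)⟩

theorem exists_measurable_argmin [Finite Φ] [Nonempty Φ] {M : Φ → Set X} {r : Φ → X → ℝ}
    (hM : ∀ φ, MeasurableSet (M φ)) (hcover : ∀ x, ∃ φ, x ∈ M φ) (hr : ∀ φ, Measurable (r φ)) :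
    ∃ sel : X → Φ, Measurable sel ∧
      ∀ x, x ∈ M (sel x) ∧ ∀ φ, x ∈ M φ → r (sel x) x ≤ r φ x := by
  have hset (φ : Φ) : {x | x ∈ M φ ∧ ∀ ψ, x ∈ M ψ → r φ x ≤ r ψ x} =
      M φ ∩ ⋂ ψ, ((M ψ)ᶜ ∪ {x | r φ x ≤ r ψ x}) := by
    ext x
    simp [imp_iff_not_or]
  refine exists_measurable_selection (E := fun φ => {x | x ∈ M φ ∧ ∀ ψ, x ∈ M ψ → r φ x ≤ r ψ x})
    (fun φ => ?_) fun x => ?_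
  · rw [hset]
    exact (hM φ).inter (.iInter fun ψ => (hM ψ).compl.union (measurableSet_le (hr φ) (hr ψ)))
  · obtain ⟨φ, hφ, hmin⟩ := Set.exists_min_image {φ | x ∈ M φ} (r · x) (Set.toFinite _) (hcover x)
    exact ⟨φ, hφ, hmin⟩

end Selection

end

noncomputable section

/-! ### Rademacher averages of set families and level sets -/

section LevelSets

variable {ι : Type*} [DecidableEq ι]

/-- Sauer–Shelah: `𝒜` has at most as many members as there are shattered sets, and each of these
contributes at least `p ^ d` to the binomial expansion of `(1 + p) ^ #X`. -/
theorem card_le_exp_of_vcDim_le {𝒜 : Finset (Finset ι)} {X : Finset ι} {d : ℕ}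
    (hX : ∀ B ∈ 𝒜, B ⊆ X) (hd : 𝒜.vcDim ≤ d) {p : ℝ} (hp : 0 < p) (hp1 : p ≤ 1) :
    (#𝒜 : ℝ) ≤ Real.exp (d * Real.log (1 / p) + p * #X) := by
  have hsub : 𝒜.shatterer ⊆ X.powerset := fun s hs => by
    obtain ⟨B, hB, hsB⟩ := (mem_shatterer.1 hs).exists_superset
    exact mem_powerset.2 (hsB.trans (hX B hB))
  have key : p ^ d * #𝒜 ≤ Real.exp (p * #X) := by
    calc p ^ d * #𝒜 ≤ p ^ d * #𝒜.shatterer := by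
          gcongr ?_ * ?_
          exact_mod_cast 𝒜.card_le_card_shatterer
      _ = ∑ _s ∈ 𝒜.shatterer, p ^ d := by rw [sum_const, nsmul_eq_mul, mul_comm]
      _ ≤ ∑ s ∈ 𝒜.shatterer, p ^ #s := sum_le_sum fun s hs =>
          pow_le_pow_of_le_one hp.le hp1 ((mem_shatterer.1 hs).card_le_vcDim.trans hd)
      _ ≤ ∑ s ∈ X.powerset, p ^ #s :=
          sum_le_sum_of_subset_of_nonneg hsub fun s _ _ => (pow_pos hp _).le
      _ = (p + 1) ^ #X := by
          rw [← sum_pow_mul_eq_add_pow]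
          simp
      _ ≤ Real.exp p ^ #X := by gcongr; exact Real.add_one_le_exp p
      _ = Real.exp (p * #X) := by rw [← Real.exp_nat_mul, mul_comm]
  have hpd : Real.exp (d * Real.log (1 / p)) = (p ^ d)⁻¹ := by
    rw [Real.exp_nat_mul, Real.exp_log (by positivity), one_div, inv_pow]
  rwa [Real.exp_add, hpd, inv_mul_eq_div, le_div_iff₀' (pow_pos hp _)]

variable [Fintype ι]

theorem expect_signedSum_mem_le (L : (ι → ℤˣ) → Finset ι) {X : Finset ι} {d : ℕ}
    (hX : ∀ σ, L σ ⊆ X) (hd : (univ.image L).vcDim ≤ d) {p c : ℝ} (hp : 0 < p) (hp1 : p ≤ 1)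
    (hc : 0 < c) :
    𝔼 σ, signedSum σ (fun t => if t ∈ L σ then 1 else 0) ≤
      (d * Real.log (1 / p) + p * #X + c ^ 2 * #X / 2) / c := by
  let ind (B : Finset ι) (t : ι) : ℝ := if t ∈ B then 1 else 0
  have hsub : ∀ B ∈ univ.image L, B ⊆ X := by simpa using hX
  refine expect_signedSum_le_of_card_le_exp ((univ.image L).image ind)
    ((Nat.cast_le.2 card_image_le).trans (card_le_exp_of_vcDim_le hsub hd hp hp1))
    (fun a ha => ?_) hc (fun σ => ind (L σ)) fun σ => mem_image_of_mem _ (by simp)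
  obtain ⟨B, hB, rfl⟩ := mem_image.1 ha
  have : ∑ t, ind B t ^ 2 = #B := by simp [ind, ite_pow]
  rw [this]
  exact_mod_cast card_le_card (hsub B hB)

theorem intervalIntegrable_ite_le (r : ℝ) :
    IntervalIntegrable (fun u : ℝ => if u ≤ r then (1 : ℝ) else 0) volume 0 1 := by
  rw [intervalIntegrable_iff, Set.uIoc_of_le zero_le_one]
  exact (integrable_const (1 : ℝ)).indicator (measurableSet_Iic (a := r))

theorem intervalIntegral_ite_le {r : ℝ} (hr : r ∈ Set.Icc (0 : ℝ) 1) :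
    ∫ u in (0 : ℝ)..1, (if u ≤ r then (1 : ℝ) else 0) = r := by
  have : (fun u : ℝ => if u ≤ r then (1 : ℝ) else 0) = (Set.Iic r).indicator 1 := rfl
  rw [intervalIntegral.integral_of_le zero_le_one, this, integral_indicator_one measurableSet_Iic,
    Measure.real, Measure.restrict_apply measurableSet_Iic, Set.Iic_inter_Ioc_of_le hr.2]
  simp [hr.1]

/-- Layer cake: Rademacher averages are the integrals of those of the level sets. -/
theorem expect_signedSum_le_integral {r : (ι → ℤˣ) → ι → ℝ}
    (hr : ∀ σ t, r σ t ∈ Set.Icc (0 : ℝ) 1) {g : ℝ → ℝ} (hg : IntervalIntegrable g volume 0 1)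
    (hle : ∀ u ∈ Set.Ioo (0 : ℝ) 1, 𝔼 σ, signedSum σ (fun t => if u ≤ r σ t then 1 else 0) ≤ g u) :
    𝔼 σ, signedSum σ (r σ) ≤ ∫ u in (0 : ℝ)..1, g u := by
  let level (σ : ι → ℤˣ) (t : ι) (u : ℝ) : ℝ := ((σ t : ℤ) : ℝ) * if u ≤ r σ t then 1 else 0
  have hlevel (σ t) : IntervalIntegrable (level σ t) volume 0 1 :=
    (intervalIntegrable_ite_le _).const_mul _
  have hsum (σ) : IntervalIntegrable (fun u => ∑ t, level σ t u) volume 0 1 := by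
    simpa only [sum_fn] using IntervalIntegrable.sum univ fun t _ => hlevel σ t
  have havg : IntervalIntegrable (fun u => 𝔼 σ, ∑ t, level σ t u) volume 0 1 := by
    simp only [Fintype.expect_eq_sum_div_card]
    simpa only [sum_fn] using (IntervalIntegrable.sum univ fun σ _ => hsum σ).div_const _
  calc 𝔼 σ, signedSum σ (r σ) = 𝔼 σ, ∑ t, ∫ u in (0 : ℝ)..1, level σ t u := by
        simp only [signedSum_apply, level, intervalIntegral.integral_const_mul,
          intervalIntegral_ite_le (hr _ _)]
    _ = ∫ u in (0 : ℝ)..1, 𝔼 σ, ∑ t, level σ t u := by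
        simp only [Fintype.expect_eq_sum_div_card, intervalIntegral.integral_div]
        rw [intervalIntegral.integral_finsetSum fun σ _ => hsum σ]
        simp only [intervalIntegral.integral_finsetSum fun t _ => hlevel _ t]
    _ ≤ ∫ u in (0 : ℝ)..1, g u :=
        intervalIntegral.integral_mono_on_of_le_Ioo zero_le_one havg hg fun u hu => by
          simpa only [signedSum_apply] using hle u hu

end LevelSets

end

noncomputable section

/-! ### Revenue from a single good -/

section FirstMax

variable {ι α : Type*} [LinearOrder ι] [LinearOrder α] {p : ι → Prop} {f : ι → α}

/-- `i` is the lowest index among those that maximize `f` subject to `p`. -/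
def IsFirstMax (p : ι → Prop) (f : ι → α) (i : ι) : Prop :=
  p i ∧ ∀ i', p i' → f i' < f i ∨ (f i' = f i ∧ i ≤ i')

theorem IsFirstMax.le {i i' : ι} (hi : IsFirstMax p f i) (hi' : p i') : f i' ≤ f i :=
  (hi.2 i' hi').elim LT.lt.le fun h => h.1.le

theorem IsFirstMax.unique {i j : ι} (hi : IsFirstMax p f i) (hj : IsFirstMax p f j) : i = j := by
  have heq : f i = f j := (hj.le hi.1).antisymm (hi.le hj.1)
  have index_le {i j : ι} (hi : IsFirstMax p f i) (hj : p j) (heq : f i = f j) : i ≤ j :=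
    ((hi.2 j hj).resolve_left heq.not_gt).2
  exact (index_le hi hj.1 heq).antisymm (index_le hj hi.1 heq.symm)

theorem exists_isFirstMax [Finite ι] (f : ι → α) (hp : ∃ i, p i) : ∃ i, IsFirstMax p f i := by
  obtain ⟨a, ha, hmax⟩ := Set.exists_max_image {i | p i} f (Set.toFinite _) hp
  obtain ⟨i, ⟨hi, hia⟩, hmin⟩ :=
    Set.exists_min_image {i | p i ∧ f i = f a} id (Set.toFinite _) ⟨a, ha, rfl⟩
  refine ⟨i, hi, fun i' hi' => (hmax i' hi').lt_or_eq.imp (hia ▸ ·) fun h => ?_⟩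
  exact ⟨h.trans hia.symm, hmin i' ⟨hi', h⟩⟩

end FirstMax

variable {n : ℕ} {rule : SaleRule} {q b : Fin n → ℝ≥0} {i : Fin n}

theorem wins_postedPrice :
    SaleRule.postedPrice.wins q b i ↔ IsFirstMax (fun i => q i ≤ b i) q i := Iff.rfl

theorem wins_secondPrice :
    SaleRule.secondPrice.wins q b i ↔ q i ≤ b i ∧ IsFirstMax (fun _ => True) b i := by
  simp [SaleRule.wins, IsFirstMax]

theorem wins_unique {j : Fin n} (hi : rule.wins q b i) (hj : rule.wins q b j) : i = j := by
  cases rule with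
  | postedPrice => exact (wins_postedPrice.1 hi).unique (wins_postedPrice.1 hj)
  | secondPrice => exact (wins_secondPrice.1 hi).2.unique (wins_secondPrice.1 hj).2

open Classical in
/-- Revenue from one good at prices `q` and bids `b`. -/
def goodRevenue (rule : SaleRule) (q b : Fin n → ℝ≥0) : ℝ≥0 :=
  ∑ i, if rule.wins q b i then rule.charge q b i else 0

theorem goodRevenue_of_wins (hi : rule.wins q b i) :
    goodRevenue rule q b = rule.charge q b i := by
  rw [goodRevenue, sum_eq_single i (fun j _ hj => if_neg fun h => hj (wins_unique h hi)) (by simp),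
    if_pos hi]

/-- The price `x` for bidder `i` secures a revenue of at least `u` at bids `b`, whatever the other
prices are. -/
def Secures (rule : SaleRule) (u x : ℝ≥0) (b : Fin n → ℝ≥0) (i : Fin n) : Prop :=
  match rule with
  | .postedPrice => u ≤ x ∧ x ≤ b i
  | .secondPrice =>
    IsFirstMax (fun _ => True) b i ∧ x ≤ b i ∧ (u ≤ x ∨ u ≤ (univ.erase i).sup b)

theorem le_goodRevenue_iff {u : ℝ≥0} (hu : 0 < u) :
    u ≤ goodRevenue rule q b ↔ ∃ i, Secures rule u (q i) b i := by
  classical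
  constructor
  · intro h
    obtain ⟨i, hi⟩ : ∃ i, rule.wins q b i := by
      by_contra! hno
      exact (hu.trans_le h).ne' (by simp [goodRevenue, hno])
    rw [goodRevenue_of_wins hi] at h
    refine ⟨i, ?_⟩
    cases rule with
    | postedPrice => exact ⟨h, hi.1⟩
    | secondPrice => exact ⟨(wins_secondPrice.1 hi).2, hi.1, le_max_iff.1 h⟩
  · rintro ⟨i, hi⟩
    cases rule with
    | postedPrice =>
      obtain ⟨a, ha⟩ := exists_isFirstMax (p := fun i => q i ≤ b i) q ⟨i, hi.2⟩
      rw [goodRevenue_of_wins (wins_postedPrice.2 ha)]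
      exact hi.1.trans (ha.le hi.2)
    | secondPrice =>
      rw [goodRevenue_of_wins (wins_secondPrice.2 ⟨hi.2.1, hi.1⟩)]
      exact le_max_iff.2 hi.2.2

namespace Secures

variable {u x y : ℝ≥0}

theorem price_le (h : Secures rule u x b i) : x ≤ b i := by
  cases rule with
  | postedPrice => exact h.2
  | secondPrice => exact h.2.1

theorem le_bid (h : Secures rule u x b i) : u ≤ b i := by
  cases rule with
  | postedPrice => exact h.1.trans h.2
  | secondPrice =>
    exact h.2.2.elim (·.trans h.2.1) (·.trans (Finset.sup_le fun j _ => h.1.le trivial))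

theorem lower (h : Secures rule u y b i) (hxy : x ≤ y) (hu : u ≤ y → u ≤ x) :
    Secures rule u x b i := by
  cases rule with
  | postedPrice => exact ⟨hu h.1, hxy.trans h.2⟩
  | secondPrice => exact ⟨h.1, hxy.trans h.2.1, h.2.2.imp_left hu⟩

theorem raise (h : Secures rule u x b i) (hxy : x ≤ y) (hy : y ≤ b i) : Secures rule u y b i := by
  cases rule with
  | postedPrice => exact ⟨h.1.trans hxy, hy⟩
  | secondPrice => exact ⟨h.1, hy, h.2.2.imp_left hxy.trans'⟩

end Secures

theorem exists_secures (h : 0 < goodRevenue rule q b) :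
    ∃ i, Secures rule (goodRevenue rule q b) (q i) b i :=
  (le_goodRevenue_iff h).1 le_rfl

theorem goodRevenue_mono_price {q' : Fin n → ℝ≥0}
    (h : ∀ i, q i ≤ b i → q i ≤ q' i ∧ q' i ≤ b i) :
    goodRevenue rule q b ≤ goodRevenue rule q' b := by
  rcases eq_zero_or_pos (goodRevenue rule q b) with h0 | hpos
  · exact h0 ▸ zero_le
  · obtain ⟨i, hi⟩ := exists_secures hpos
    exact (le_goodRevenue_iff hpos).2 ⟨i, hi.raise (h i hi.price_le).1 (h i hi.price_le).2⟩

theorem goodRevenue_le_sup (rule : SaleRule) (q b : Fin n → ℝ≥0) :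
    goodRevenue rule q b ≤ univ.sup b := by
  rcases eq_zero_or_pos (goodRevenue rule q b) with h0 | hpos
  · exact h0 ▸ zero_le
  · obtain ⟨i, hi⟩ := exists_secures hpos
    exact hi.le_bid.trans (le_sup (mem_univ i))

theorem sup_le_goodRevenue (rule : SaleRule) (b : Fin n → ℝ≥0) :
    univ.sup b ≤ goodRevenue rule (fun _ => univ.sup b) b := by
  rcases eq_zero_or_pos (univ.sup b) with h0 | hpos
  · exact h0 ▸ zero_le
  · obtain ⟨i₀, -⟩ := Finset.lt_sup_iff.1 hpos
    obtain ⟨i, hi⟩ := exists_isFirstMax (p := fun _ => True) b ⟨i₀, trivial⟩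
    have hb : univ.sup b ≤ b i := Finset.sup_le fun j _ => hi.le trivial
    refine (le_goodRevenue_iff hpos).2 ⟨i, ?_⟩
    cases rule with
    | postedPrice => exact ⟨le_rfl, hb⟩
    | secondPrice => exact ⟨hi, hb, Or.inl le_rfl⟩

theorem goodRevenue_eq_zero (h : ∀ i, b i < q i) : goodRevenue rule q b = 0 := by
  by_contra h0
  obtain ⟨i, hi⟩ := exists_secures (pos_iff_ne_zero.2 h0)
  exact (h i).not_ge hi.price_le

theorem goodRevenue_one (rule : SaleRule) (q b : Fin 1 → ℝ≥0) :
    goodRevenue rule q b = if q 0 ≤ b 0 then q 0 else 0 := by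
  split_ifs with h
  · have wins : rule.wins q b 0 := by
      cases rule <;> exact ⟨h, by simp [Fin.forall_fin_one]⟩
    rw [goodRevenue_of_wins wins]
    cases rule <;> simp [SaleRule.charge]
  · exact goodRevenue_eq_zero fun i => by simpa [Subsingleton.elim i 0] using h

section Measurability

variable {X : Type*} [MeasurableSpace X] {q b : X → Fin n → ℝ≥0}

theorem measurableSet_isFirstMax {p : X → Fin n → Prop} (hp : ∀ i, MeasurableSet {x | p x i})
    (hb : Measurable b) (i : Fin n) : MeasurableSet {x | IsFirstMax (p x) (b x) i} := by
  have hb' (i) : Measurable fun x => b x i := (measurable_pi_apply i).comp hb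
  refine (hp i).inter (measurableSet_setOfPred.2 (Measurable.forall fun i' => ?_))
  exact measurableSet_setOfPred.1 ((hp i').imp ((measurableSet_lt (hb' i') (hb' i)).union
    ((measurableSet_eq_fun (hb' i') (hb' i)).inter (.const _))))

theorem measurable_finset_sup {ι : Type*} (s : Finset ι) {b : X → ι → ℝ≥0} (hb : Measurable b) :
    Measurable fun x => s.sup (b x) := by
  classical
  induction s using Finset.induction_on with
  | empty => simp
  | insert i s _ ih =>
    simp only [sup_insert]
    exact ((measurable_pi_apply i).comp hb).sup ih

theorem measurable_goodRevenue (rule : SaleRule) (hq : Measurable q) (hb : Measurable b) :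
    Measurable fun x => goodRevenue rule (q x) (b x) := by
  have hq' (i) : Measurable fun x => q x i := (measurable_pi_apply i).comp hq
  have hmeets (i) : MeasurableSet {x | q x i ≤ b x i} :=
    measurableSet_le (hq' i) ((measurable_pi_apply i).comp hb)
  refine Finset.measurable_sum _ fun i _ => Measurable.ite ?_ ?_ measurable_const
  · cases rule with
    | postedPrice => simpa only [wins_postedPrice] using measurableSet_isFirstMax hmeets hq i
    | secondPrice =>
      simp only [wins_secondPrice]
      exact (hmeets i).inter (measurableSet_isFirstMax (fun _ => .const _) hb i)
  · cases rule with
    | postedPrice => exact hq' i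
    | secondPrice => exact (hq' i).max (measurable_finset_sup _ hb)

end Measurability

/-! ### Rademacher average of the revenue from one good -/

section GoodRademacher

variable {ι : Type*} [Fintype ι]

/-- The sample points `t` at which prices `q` raise a revenue of at least `u` from bids `b t`. -/
def levelSet (rule : SaleRule) (b : ι → Fin n → ℝ≥0) (u : ℝ≥0) (q : Fin n → ℝ≥0) : Finset ι :=
  {t | u ≤ goodRevenue rule q (b t)}

theorem mem_levelSet {b : ι → Fin n → ℝ≥0} {u : ℝ≥0} {t : ι} :
    t ∈ levelSet rule b u q ↔ u ≤ goodRevenue rule q (b t) := by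
  simp [levelSet]

/-- If the level sets of prices `q t` separate the points `t` of a set, then each `t` is assigned a
bidder that secures `u` there and the truth value of `u ≤ q t i` for this bidder. No two points
share both, since the lower one of the two prices would then secure `u` at both points. -/
theorem card_le_of_separates {b : ι → Fin n → ℝ≥0} {u : ℝ≥0} (hu : 0 < u) {s : Finset ι}
    {q : s → Fin n → ℝ≥0} (hq : ∀ t t' : s, t'.1 ∈ levelSet rule b u (q t) ↔ t' = t) :
    #s ≤ 2 * n := by
  have hsec (t : s) : ∃ i, Secures rule u (q t i) (b t) i :=
    (le_goodRevenue_iff hu).1 (mem_levelSet.1 ((hq t t).2 rfl))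
  choose i hi using hsec
  have eq_of_le (t t' : s) (hbidder : i t = i t') (htruth : u ≤ q t (i t) ↔ u ≤ q t' (i t'))
      (hle : q t (i t) ≤ q t' (i t')) : t' = t := by
    have : Secures rule u (q t (i t)) (b t') (i t) := by
      rw [hbidder] at hle htruth ⊢
      exact (hi t').lower hle htruth.2
    exact (hq t t').1 (mem_levelSet.2 ((le_goodRevenue_iff hu).2 ⟨_, this⟩))
  have inj : Function.Injective fun t : s => (i t, decide (u ≤ q t (i t))) := fun t t' heq => by
    simp only [Prod.mk.injEq, decide_eq_decide] at heq
    rcases le_total (q t (i t)) (q t' (i t')) with h | h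
    · exact (eq_of_le t t' heq.1 heq.2 h).symm
    · exact eq_of_le t' t heq.1.symm heq.2.symm h
  simpa [mul_comm] using Fintype.card_le_of_injective _ inj

variable [DecidableEq ι]

theorem vcDim_image_levelSet_le {κ : Type*} [Fintype κ] {b : ι → Fin n → ℝ≥0} {u : ℝ≥0}
    (hu : 0 < u) (q : κ → Fin n → ℝ≥0) :
    (univ.image fun σ => levelSet rule b u (q σ)).vcDim ≤ 2 * n := by
  refine Finset.sup_le fun s hs => ?_
  have hsep (t : s) : ∃ σ, s ∩ levelSet rule b u (q σ) = {t.1} := by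
    obtain ⟨B, hB, hst⟩ := (mem_shatterer.1 hs).exists_inter_eq_singleton t.2
    obtain ⟨σ, -, rfl⟩ := mem_image.1 hB
    exact ⟨σ, hst⟩
  choose σ hσ using hsep
  refine card_le_of_separates (rule := rule) (b := b) hu (q := fun t => q (σ t)) fun t t' => ?_
  have := Finset.ext_iff.1 (hσ t) t'.1
  rw [mem_inter, mem_singleton, and_iff_right t'.2] at this
  exact this.trans Subtype.ext_iff.symm

/-- The choice `p = δ² w⁴`, `c = δ w²` balances the three terms of the bound on the level set at
height `u = w⁴`. -/
theorem level_tradeoff {a w δ x M : ℝ} (ha : 0 ≤ a) (hw : 0 < w) (hw1 : w ≤ 1) (hδ : 0 < δ)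
    (hlog : 1 / 2 ≤ Real.log (1 / δ)) (hM : a * Real.log (1 / δ) ≤ M * δ ^ 2)
    (hx : w ^ 4 * x ≤ M) :
    (2 * a * Real.log (1 / (δ ^ 2 * w ^ 4)) + δ ^ 2 * w ^ 4 * x + (δ * w ^ 2) ^ 2 * x / 2) /
      (δ * w ^ 2) ≤ 22 * δ * M * (1 / w ^ 3) := by
  have log_split : Real.log (1 / (δ ^ 2 * w ^ 4)) =
      2 * Real.log (1 / δ) + 4 * Real.log (1 / w) := by
    simp only [one_div, Real.log_inv]
    rw [Real.log_mul (by positivity) (by positivity), Real.log_pow, Real.log_pow]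
    push_cast
    ring
  have log_le : w * Real.log (1 / w) ≤ 1 := by
    calc w * Real.log (1 / w) ≤ w * (1 / w) := by
          gcongr
          exact Real.log_le_self (by positivity)
      _ = 1 := by field_simp
  have ha2 : a ≤ 2 * (M * δ ^ 2) := by nlinarith
  have hM0 : 0 ≤ M * δ ^ 2 := by linarith
  have size : (2 * a * Real.log (1 / (δ ^ 2 * w ^ 4))) * w ≤ 20 * (M * δ ^ 2) := by
    have : a * (w * Real.log (1 / w)) ≤ a := mul_le_of_le_one_right ha log_le
    have : a * Real.log (1 / δ) * w ≤ M * δ ^ 2 :=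
      (mul_le_mul_of_nonneg_right hM hw.le).trans (mul_le_of_le_one_right hM0 hw1)
    rw [log_split]
    linarith
  have mass : δ ^ 2 * (w ^ 4 * x) * w ≤ M * δ ^ 2 := by
    calc δ ^ 2 * (w ^ 4 * x) * w ≤ M * δ ^ 2 * w := by
          rw [mul_comm (δ ^ 2)]
          gcongr
      _ ≤ M * δ ^ 2 := mul_le_of_le_one_right hM0 hw1
  rw [div_le_iff₀ (by positivity)]
  calc _ = (2 * a * Real.log (1 / (δ ^ 2 * w ^ 4)) * w +
        3 / 2 * (δ ^ 2 * (w ^ 4 * x) * w)) / w := by field_simp; ring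
    _ ≤ 22 * (M * δ ^ 2) / w := by gcongr; linarith
    _ = 22 * δ * M * (1 / w ^ 3) * (δ * w ^ 2) := by field_simp

variable {b : ι → Fin n → ℝ≥0}

theorem expect_signedSum_level_le {δ M u : ℝ} (hδ : 0 < δ) (hlog : 1 / 2 ≤ Real.log (1 / δ))
    (hM : n * Real.log (1 / δ) ≤ M * δ ^ 2) (hb : ∑ t, ((univ.sup (b t) : ℝ≥0) : ℝ) ≤ M)
    (q : (ι → ℤˣ) → Fin n → ℝ≥0) (hu : u ∈ Set.Ioo (0 : ℝ) 1) :
    𝔼 σ, signedSum σ (fun t => if u ≤ goodRevenue rule (q σ) (b t) then 1 else 0) ≤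
      22 * δ * M * u ^ (-(3 / 4) : ℝ) := by
  lift u to ℝ≥0 using hu.1.le
  have hu0 : 0 < u := hu.1
  let w : ℝ := (u : ℝ) ^ (1 / 4 : ℝ)
  have hw0 : 0 < w := Real.rpow_pos_of_pos hu.1 _
  have hw1 : w ≤ 1 := Real.rpow_le_one hu.1.le hu.2.le (by norm_num)
  have hw4 : w ^ 4 = u := by
    rw [← Real.rpow_natCast, ← Real.rpow_mul hu.1.le]
    norm_num
  have hw3 : (u : ℝ) ^ (-(3 / 4) : ℝ) = 1 / w ^ 3 := by
    rw [← Real.rpow_natCast, ← Real.rpow_mul hu.1.le, Real.rpow_neg hu.1.le, one_div]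
    norm_num
  have hδ1 : δ ≤ 1 := by
    by_contra! h
    linarith [Real.log_nonpos (x := 1 / δ) (by positivity) ((div_le_one hδ).2 h.le)]
  let X : Finset ι := {t | u ≤ univ.sup (b t)}
  have hX : w ^ 4 * #X ≤ M := by
    rw [hw4, mul_comm, ← nsmul_eq_mul]
    refine (card_nsmul_le_sum X (fun t => ((univ.sup (b t) : ℝ≥0) : ℝ)) u fun t ht => ?_).trans
      ((sum_le_sum_of_subset_of_nonneg (subset_univ X) fun _ _ _ => NNReal.coe_nonneg _).trans hb)
    exact_mod_cast (mem_filter.1 ht).2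
  have hsub (σ) : levelSet rule b u (q σ) ⊆ X := fun t ht =>
    mem_filter.2 ⟨mem_univ t, (mem_levelSet.1 ht).trans (goodRevenue_le_sup _ _ _)⟩
  have hmassart := expect_signedSum_mem_le (fun σ => levelSet rule b u (q σ)) hsub
    (vcDim_image_levelSet_le hu0 q) (p := δ ^ 2 * w ^ 4) (c := δ * w ^ 2) (by positivity)
    (mul_le_one₀ (pow_le_one₀ hδ.le hδ1) (by positivity) (pow_le_one₀ hw0.le hw1)) (by positivity)
  simp only [mem_levelSet, Nat.cast_mul, Nat.cast_ofNat] at hmassart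
  simp only [NNReal.coe_le_coe]
  exact hmassart.trans (hw3 ▸ level_tradeoff n.cast_nonneg hw0 hw1 hδ hlog hM hX)

theorem expect_signedSum_goodRevenue_le {δ M : ℝ} (hδ : 0 < δ) (hlog : 1 / 2 ≤ Real.log (1 / δ))
    (hM : n * Real.log (1 / δ) ≤ M * δ ^ 2) (hb : ∑ t, ((univ.sup (b t) : ℝ≥0) : ℝ) ≤ M)
    (hb1 : ∀ t, univ.sup (b t) ≤ 1) (q : (ι → ℤˣ) → Fin n → ℝ≥0) :
    𝔼 σ, signedSum σ (fun t => (goodRevenue rule (q σ) (b t) : ℝ)) ≤ 88 * δ * M := by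
  refine (expect_signedSum_le_integral (fun σ t => ⟨NNReal.coe_nonneg _, ?_⟩)
    ((intervalIntegral.intervalIntegrable_rpow' (by norm_num)).const_mul _)
    fun u hu => expect_signedSum_level_le hδ hlog hM hb q hu).trans_eq ?_
  · exact_mod_cast (goodRevenue_le_sup _ _ _).trans (hb1 t)
  · rw [intervalIntegral.integral_const_mul, integral_rpow (Or.inl (by norm_num))]
    norm_num
    ring

end GoodRademacher

end

noncomputable section

/-! ### Pricing classes as separate sales of several goods -/

variable {n k : ℕ} {rule : SaleRule}

/-- A description of the class `A` as the separate sale of the goods in `Good` by `rule`. Prices are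
set for pools of bidders (one pool in the anonymous classes, a pool for each bidder in the others),
and `bid j v i` is the value of bidder `i` for good `j`. -/
structure SeparateSale {Pool Good : Type} [Fintype Good] (rule : SaleRule) (A : AuctionClass n k)
    (pool : Fin n → Pool) (bid : Good → Profile n k → Fin n → ℝ≥0) where
  price : A.Hyp ≃ (Pool → Good → ℝ≥0)
  pool_surjective : pool.Surjective
  measurable_bid : ∀ j, Measurable (bid j)
  revenue_eq : ∀ h v, (A.mech h).revenue v =
    ∑ j, (goodRevenue rule (fun i => price h (pool i) j) (bid j v) : ℝ)
  mem_onSample : ∀ h T, h ∈ A.onSample T ↔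
    ∀ a j, ∃ v ∈ T, ∃ i, pool i = a ∧ price h a j = bid j v i

/-- The bids in the sale of the grand bundle, the only good. -/
def bundleBid (_ : Unit) (v : Profile n k) (i : Fin n) : ℝ≥0 := ∑ j, v i j

/-- The bids in the separate sale of the items. -/
def itemBid (j : Fin k) (v : Profile n k) (i : Fin n) : ℝ≥0 := v i j

theorem measurable_bundleBid (u : Unit) : Measurable (bundleBid (n := n) (k := k) u) := by
  unfold bundleBid
  fun_prop

theorem measurable_itemBid (j : Fin k) : Measurable (itemBid (n := n) j) := by
  unfold itemBid
  fun_prop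

theorem bundleMechanism_revenue (rule : SaleRule) (q : Fin n → ℝ≥0) (v : Profile n k) :
    (bundleMechanism rule q).revenue v = goodRevenue rule q (bundleBid () v) := by
  simp only [Mechanism.revenue, bundleMechanism, goodRevenue, NNReal.coe_sum,
    apply_ite NNReal.toReal, NNReal.coe_zero]
  rfl

theorem itemMechanism_revenue (rule : SaleRule) (q : Fin n → Fin k → ℝ≥0) (v : Profile n k) :
    (itemMechanism rule q).revenue v =
      ∑ j, (goodRevenue rule (fun i => q i j) (itemBid j v) : ℝ) := by
  simp only [Mechanism.revenue, itemMechanism, goodRevenue, NNReal.coe_sum,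
    apply_ite NNReal.toReal, NNReal.coe_zero]
  rw [sum_comm]
  rfl

/-- Anonymous bundle pricing: one good and one pool. -/
def anonymousBundleSale [NeZero n] :
    SeparateSale rule (anonymousBundlePricing rule n k) (fun _ => ()) bundleBid where
  price := ((Equiv.funUnique Unit _).trans (Equiv.funUnique Unit ℝ≥0)).symm
  pool_surjective := Function.surjective_to_subsingleton _
  measurable_bid := measurable_bundleBid
  revenue_eq h v := by
    rw [univ_unique, sum_singleton]
    exact bundleMechanism_revenue rule (fun _ => h) v
  mem_onSample _ _ := ⟨fun ⟨v, hv, i, hi⟩ _ _ => ⟨v, hv, i, rfl, hi⟩,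
    fun H => let ⟨v, hv, i, _, hi⟩ := H () (); ⟨v, hv, i, hi⟩⟩

/-- Bundle pricing: one good and a pool for each bidder. -/
def bundleSale : SeparateSale rule (bundlePricing rule n k) id bundleBid where
  price := Equiv.piCongrRight fun _ => (Equiv.funUnique Unit ℝ≥0).symm
  pool_surjective := Function.surjective_id
  measurable_bid := measurable_bundleBid
  revenue_eq h v := by
    rw [univ_unique, sum_singleton]
    exact bundleMechanism_revenue rule h v
  mem_onSample _ _ := ⟨fun H i _ => let ⟨v, hv, hi⟩ := H i; ⟨v, hv, i, rfl, hi⟩,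
    fun H i => let ⟨v, hv, _, hi', hi⟩ := H i (); ⟨v, hv, hi' ▸ hi⟩⟩

/-- Anonymous item pricing: the items are the goods, with one pool. -/
def anonymousItemSale [NeZero n] :
    SeparateSale rule (anonymousItemPricing rule n k) (fun _ => ()) itemBid where
  price := (Equiv.funUnique Unit _).symm
  pool_surjective := Function.surjective_to_subsingleton _
  measurable_bid := measurable_itemBid
  revenue_eq h v := itemMechanism_revenue rule (fun _ => h) v
  mem_onSample _ _ := ⟨fun H _ j => let ⟨v, hv, i, hi⟩ := H j; ⟨v, hv, i, rfl, hi⟩,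
    fun H j => let ⟨v, hv, i, _, hi⟩ := H () j; ⟨v, hv, i, hi⟩⟩

/-- Item pricing: the items are the goods, with a pool for each bidder. -/
def itemSale : SeparateSale rule (itemPricing rule n k) id itemBid where
  price := Equiv.refl _
  pool_surjective := Function.surjective_id
  measurable_bid := measurable_itemBid
  revenue_eq h v := itemMechanism_revenue rule h v
  mem_onSample _ _ := ⟨fun H i j => let ⟨v, hv, hi⟩ := H i j; ⟨v, hv, i, rfl, hi⟩,
    fun H i j => let ⟨v, hv, _, hi', hi⟩ := H i j; ⟨v, hv, hi' ▸ hi⟩⟩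

/-! ### Rounding prices to sample values -/

theorem exists_mem_between {α : Type*} [LinearOrder α] {C : Finset α} (hC : C.Nonempty) (x : α) :
    ∃ y ∈ C, ∀ c ∈ C, x ≤ c → x ≤ y ∧ y ≤ c := by
  by_cases h : {c ∈ C | x ≤ c}.Nonempty
  · obtain ⟨y, hy, hmin⟩ := exists_min_image _ id h
    simp only [mem_filter, id, and_imp] at hy hmin
    exact ⟨y, hy.1, fun c hc hxc => ⟨hy.2, hmin c hc hxc⟩⟩
  · obtain ⟨y, hy⟩ := hC
    exact ⟨y, hy, fun c hc hxc => (h ⟨c, mem_filter.2 ⟨hc, hxc⟩⟩).elim⟩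

namespace SeparateSale

variable {Pool Good : Type} {A : AuctionClass n k} {pool : Fin n → Pool}
  {bid : Good → Profile n k → Fin n → ℝ≥0} {T : Multiset (Profile n k)}

open Classical in
/-- The sample values that may serve as the price of good `j` for the bidders in pool `a`. -/
def candidates (pool : Fin n → Pool) (bid : Good → Profile n k → Fin n → ℝ≥0)
    (T : Multiset (Profile n k)) (a : Pool) (j : Good) : Finset ℝ≥0 :=
  (T.toFinset ×ˢ ({i | pool i = a} : Finset (Fin n))).image fun p => bid j p.1 p.2

theorem mem_candidates {a : Pool} {j : Good} {x : ℝ≥0} :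
    x ∈ candidates pool bid T a j ↔ ∃ v ∈ T, ∃ i, pool i = a ∧ x = bid j v i := by
  simp only [candidates, mem_image, mem_product, Multiset.mem_toFinset, mem_filter_univ,
    Prod.exists, and_assoc, exists_and_left, @eq_comm _ x]

open Classical in
theorem card_candidates_le (T : Multiset (Profile n k)) (a : Pool) (j : Good) :
    #(candidates pool bid T a j) ≤ T.card * #{i | pool i = a} :=
  card_image_le.trans <| (card_product _ _).trans_le <|
    Nat.mul_le_mul_right _ (Multiset.toFinset_card_le T)

variable [Fintype Good] (P : SeparateSale rule A pool bid)
include P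

theorem mem_onSample_iff {h : A.Hyp} :
    h ∈ A.onSample T ↔ ∀ a j, P.price h a j ∈ candidates pool bid T a j := by
  simp only [P.mem_onSample, mem_candidates]

theorem candidates_nonempty (hT : T ≠ 0) (a : Pool) (j : Good) :
    (candidates pool bid T a j).Nonempty := by
  obtain ⟨v, hv⟩ := Multiset.exists_mem_of_ne_zero hT
  obtain ⟨i, hi⟩ := P.pool_surjective a
  exact ⟨_, mem_candidates.2 ⟨v, hv, i, hi, rfl⟩⟩

theorem onSample_mono {S : Multiset (Profile n k)} (hTS : T ⊆ S) :
    A.onSample T ⊆ A.onSample S := fun h hh => (P.mem_onSample h S).2 fun a j =>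
  let ⟨v, hv, hi⟩ := (P.mem_onSample h T).1 hh a j
  ⟨v, hTS hv, hi⟩

open Classical in
theorem encard_onSample_le [Fintype Pool] (T : Multiset (Profile n k)) {c : ℕ}
    (hc : ∀ a, #{i | pool i = a} ≤ c) :
    (A.onSample T).encard ≤
      ((T.card * c) ^ (Fintype.card Pool * Fintype.card Good) : ℕ) := by
  let prices : Finset (Pool → Good → ℝ≥0) :=
    Fintype.piFinset fun a => Fintype.piFinset (candidates pool bid T a)
  have hsub : P.price '' A.onSample T ⊆ prices := by
    rintro _ ⟨h, hh, rfl⟩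
    simpa [prices] using P.mem_onSample_iff.1 hh
  have hcard : #prices ≤ (T.card * c) ^ (Fintype.card Pool * Fintype.card Good) := by
    simp only [prices, Fintype.card_piFinset]
    calc ∏ a, ∏ j, #(candidates pool bid T a j)
        ≤ ∏ _a : Pool, ∏ _j : Good, T.card * c := by
          gcongr with a _ j _
          exact (card_candidates_le T a j).trans (Nat.mul_le_mul_left _ (hc a))
      _ = _ := by simp only [prod_const, card_univ, ← pow_mul, mul_comm]
  rw [← P.price.injective.encard_image]
  refine (Set.encard_le_encard hsub).trans ?_
  rw [Set.encard_coe_eq_coe_finsetCard]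
  exact_mod_cast hcard

theorem exists_onSample_ge (hT : T ≠ 0) (h : A.Hyp) :
    ∃ h' ∈ A.onSample T, ∀ v ∈ T, (A.mech h).revenue v ≤ (A.mech h').revenue v := by
  choose y hy hround using fun a j =>
    exists_mem_between (P.candidates_nonempty hT a j) (P.price h a j)
  refine ⟨P.price.symm y, P.mem_onSample_iff.2 fun a j => by simpa using hy a j, fun v hv => ?_⟩
  rw [P.revenue_eq, P.revenue_eq, Equiv.apply_symm_apply]
  exact sum_le_sum fun j _ => NNReal.coe_le_coe.2 <| goodRevenue_mono_price fun i hi =>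
    hround (pool i) j _ (mem_candidates.2 ⟨v, hv, i, rfl, rfl⟩) hi

theorem exists_isMaximizer [Finite Pool] (hT : T ≠ 0) :
    ∃ h ∈ A.onSample T, A.IsMaximizer T h := by
  classical
  have := Fintype.ofFinite Pool
  have hfin : (A.onSample T).Finite :=
    Set.finite_of_encard_le_coe (P.encard_onSample_le T fun a => card_le_univ {i | pool i = a})
  obtain ⟨h₀, hh₀, -⟩ := P.exists_onSample_ge hT (P.price.symm 0)
  obtain ⟨h, hh, hmax⟩ := Set.exists_max_image _ (A.empRevenue T) hfin ⟨h₀, hh₀⟩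
  refine ⟨h, hh, fun g => ?_⟩
  obtain ⟨g', hg', hle⟩ := P.exists_onSample_ge hT g
  calc A.empRevenue T g ≤ A.empRevenue T g' :=
        div_le_div_of_nonneg_right (Multiset.sum_map_le_sum_map _ _ hle) (Nat.cast_nonneg _)
    _ ≤ A.empRevenue T h := hmax g' hg'

theorem measurable_revenue_comp {X : Type*} [MeasurableSpace X] {q : X → Pool → Good → ℝ≥0}
    {v : X → Profile n k} (hq : ∀ a j, Measurable fun x => q x a j) (hv : Measurable v) :
    Measurable fun x => (A.mech (P.price.symm (q x))).revenue (v x) := by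
  simp only [P.revenue_eq, Equiv.apply_symm_apply]
  exact Finset.measurable_sum _ fun j _ => (measurable_goodRevenue rule
    (measurable_pi_lambda _ fun i => hq (pool i) j) ((P.measurable_bid j).comp hv)).coe_nnreal_real

end SeparateSale

/-! ### Well-behaved classes -/

/-- The properties of a class of auctions on which learning by empirical revenue maximization
rests: some empirical maximizer uses sample values, and the hypotheses with sample values are
finitely many measurable functions of the sample. -/
structure AuctionClass.IsTame (A : AuctionClass n k) : Prop where
  exists_isMaximizer : ∀ T ≠ 0, ∃ h ∈ A.onSample T, A.IsMaximizer T h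
  onSample_mono : ∀ {T S : Multiset (Profile n k)}, T ⊆ S → A.onSample T ⊆ A.onSample S
  indexed : ∀ m, ∃ (Φ : Type) (_ : Fintype Φ) (hyp : Φ → (Fin m → Profile n k) → A.Hyp),
    (∀ s, A.onSample (univ.val.map s) = Set.range fun φ => hyp φ s) ∧
    ∀ φ, Measurable fun p : (Fin m → Profile n k) × Profile n k =>
      (A.mech (hyp φ p.1)).revenue p.2
  measurable_revenue : ∀ h, Measurable (A.mech h).revenue

theorem SeparateSale.isTame {Pool Good : Type} [Finite Pool] [Fintype Good] {A : AuctionClass n k}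
    {pool : Fin n → Pool} {bid : Good → Profile n k → Fin n → ℝ≥0}
    (P : SeparateSale rule A pool bid) : A.IsTame where
  exists_isMaximizer _ hT := P.exists_isMaximizer hT
  onSample_mono := P.onSample_mono
  indexed m := by
    classical
    have := Fintype.ofFinite Pool
    refine ⟨(a : Pool) → Good → Fin m × {i // pool i = a}, inferInstance,
      fun φ s => P.price.symm fun a j => bid j (s (φ a j).1) (φ a j).2, fun s => ?_, fun φ =>
      P.measurable_revenue_comp (fun a j => ?_) measurable_snd⟩
    · ext h
      simp only [P.mem_onSample, Multiset.mem_map, mem_val, mem_univ, true_and, Set.mem_range,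
        exists_exists_eq_and]
      constructor
      · intro H
        choose t i hi hp using H
        exact ⟨fun a j => (t a j, ⟨i a j, hi a j⟩), P.price.symm_apply_eq.2
          (funext₂ fun a j => (hp a j).symm)⟩
      · rintro ⟨φ, rfl⟩ a j
        exact ⟨(φ a j).1, (φ a j).2, (φ a j).2.2, by rw [Equiv.apply_symm_apply]⟩
    · exact (measurable_pi_apply _).comp ((P.measurable_bid j).comp
        ((measurable_pi_apply _).comp measurable_fst))
  measurable_revenue h := by
    simpa using P.measurable_revenue_comp (q := fun _ => P.price h) (fun _ _ => measurable_const)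
      measurable_id

namespace AuctionClass.IsTame

variable {A B : AuctionClass n k}

theorem bestOf (hA : A.IsTame) (hB : B.IsTame) : (bestOf A B).IsTame where
  exists_isMaximizer T hT := by
    obtain ⟨a, ha, hamax⟩ := hA.exists_isMaximizer T hT
    obtain ⟨b, hb, hbmax⟩ := hB.exists_isMaximizer T hT
    rcases le_total (A.empRevenue T a) (B.empRevenue T b) with hab | hab
    · exact ⟨Sum.inr b, Or.inr ⟨b, hb, rfl⟩, Sum.rec (fun h => (hamax h).trans hab) hbmax⟩
    · exact ⟨Sum.inl a, Or.inl ⟨a, ha, rfl⟩, Sum.rec hamax fun h => (hbmax h).trans hab⟩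
  onSample_mono hTS := Set.union_subset_union (Set.image_mono (hA.onSample_mono hTS))
    (Set.image_mono (hB.onSample_mono hTS))
  indexed m := by
    obtain ⟨Φ, _, f, hf, hfm⟩ := hA.indexed m
    obtain ⟨Ψ, _, g, hg, hgm⟩ := hB.indexed m
    refine ⟨Φ ⊕ Ψ, inferInstance,
      fun x s => x.elim (fun φ => Sum.inl (f φ s)) (fun ψ => Sum.inr (g ψ s)), fun s => ?_,
      Sum.rec hfm hgm⟩
    change Sum.inl '' A.onSample _ ∪ Sum.inr '' B.onSample _ = _
    rw [hf, hg, Sum.range_eq, ← Set.range_comp, ← Set.range_comp]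
    rfl
  measurable_revenue := Sum.rec hA.measurable_revenue hB.measurable_revenue

theorem ermOnSample (hA : A.IsTame) : A.ERMOnSample :=
  ⟨hA.exists_isMaximizer, fun _ herm T hT => herm.favors_sample T hT (hA.exists_isMaximizer T hT)⟩

theorem growthLE (hA : A.IsTame) {m N : ℕ} (hm : 0 < m)
    (hN : ∀ S : Multiset (Profile n k), S.card = m → (A.onSample S).encard ≤ N) :
    A.GrowthLE m N := by
  intro erm herm
  refine iSup₂_le fun S hS => (Set.encard_le_encard ?_).trans (hN S hS)
  rintro _ ⟨T, hTS, hT, rfl⟩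
  have hT0 : T ≠ 0 := Multiset.card_pos.1 (by omega)
  exact hA.onSample_mono (Multiset.subset_of_le hTS) (hA.ermOnSample.2 erm herm T hT0)

end AuctionClass.IsTame

section PricingClasses

theorem isTame_anonymousBundlePricing [NeZero n] : (anonymousBundlePricing rule n k).IsTame :=
  anonymousBundleSale.isTame

theorem isTame_bundlePricing : (bundlePricing rule n k).IsTame := bundleSale.isTame

theorem isTame_anonymousItemPricing [NeZero n] : (anonymousItemPricing rule n k).IsTame :=
  anonymousItemSale.isTame

theorem isTame_itemPricing : (itemPricing rule n k).IsTame := itemSale.isTame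

theorem isTame_anonymousBestPricing [NeZero n] : (anonymousBestPricing rule n k).IsTame :=
  isTame_anonymousBundlePricing.bestOf isTame_anonymousItemPricing

theorem isTame_bestPricing : (bestPricing rule n k).IsTame :=
  isTame_bundlePricing.bestOf isTame_itemPricing

/-! ### Split-sample growth -/

variable {S : Multiset (Profile n k)} {m : ℕ}

theorem growthLE_one (A : AuctionClass n k) : A.GrowthLE 1 1 := by
  intro erm _
  refine iSup₂_le fun S hS => ?_
  have hsub : splitSampleSpace erm S ⊆ {erm S} := by
    rintro _ ⟨T, hTS, hT, rfl⟩
    rw [Set.mem_singleton_iff, Multiset.eq_of_le_of_card_le hTS (by omega)]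
  simpa using Set.encard_le_encard hsub

theorem encard_onSample_bestOf_le {A B : AuctionClass n k} {x d : ℕ} (hx : 2 ≤ x) (hd : 0 < d)
    (hA : (A.onSample S).encard ≤ x) (hB : (B.onSample S).encard ≤ (x ^ d : ℕ)) :
    ((bestOf A B).onSample S).encard ≤ (x ^ (d + 1) : ℕ) := by
  have hunion : ((bestOf A B).onSample S).encard ≤ (x : ℕ∞) + (x ^ d : ℕ) :=
    (Set.encard_union_le _ _).trans (add_le_add ((Sum.inl_injective.encard_image _).trans_le hA)
      ((Sum.inr_injective.encard_image _).trans_le hB))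
  have hpow : x + x ^ d ≤ x ^ (d + 1) := by
    calc x + x ^ d ≤ 2 * x ^ d := by linarith [Nat.le_self_pow hd.ne' x]
      _ ≤ x * x ^ d := Nat.mul_le_mul_right _ hx
      _ = x ^ (d + 1) := by ring
  exact hunion.trans (mod_cast hpow)

theorem encard_onSample_anonymousBundlePricing [NeZero n] (S : Multiset (Profile n k)) :
    ((anonymousBundlePricing rule n k).onSample S).encard ≤ (S.card * n : ℕ) := by
  simpa using (anonymousBundleSale (rule := rule)).encard_onSample_le S (c := n) (by simp)

theorem encard_onSample_bundlePricing (S : Multiset (Profile n k)) :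
    ((bundlePricing rule n k).onSample S).encard ≤ (S.card ^ n : ℕ) := by
  simpa using (bundleSale (rule := rule)).encard_onSample_le S (c := 1) (by simp [filter_eq'])

theorem encard_onSample_anonymousItemPricing [NeZero n] (S : Multiset (Profile n k)) :
    ((anonymousItemPricing rule n k).onSample S).encard ≤ ((n * S.card) ^ k : ℕ) := by
  simpa [mul_comm n] using
    (anonymousItemSale (rule := rule)).encard_onSample_le S (c := n) (by simp)

theorem encard_onSample_itemPricing (S : Multiset (Profile n k)) :
    ((itemPricing rule n k).onSample S).encard ≤ (S.card ^ (n * k) : ℕ) := by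
  simpa using (itemSale (rule := rule)).encard_onSample_le S (c := 1) (by simp [filter_eq'])

theorem growthLE_anonymousBundlePricing [NeZero n] (hm : 0 < m) :
    (anonymousBundlePricing rule n k).GrowthLE m (m * n) :=
  isTame_anonymousBundlePricing.growthLE hm fun S hS =>
    hS ▸ encard_onSample_anonymousBundlePricing S

theorem growthLE_bundlePricing (hm : 0 < m) : (bundlePricing rule n k).GrowthLE m (m ^ n) :=
  isTame_bundlePricing.growthLE hm fun S hS => hS ▸ encard_onSample_bundlePricing S

theorem growthLE_anonymousItemPricing [NeZero n] (hm : 0 < m) :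
    (anonymousItemPricing rule n k).GrowthLE m ((n * m) ^ k) :=
  isTame_anonymousItemPricing.growthLE hm fun S hS => hS ▸ encard_onSample_anonymousItemPricing S

theorem growthLE_itemPricing (hm : 0 < m) :
    (itemPricing rule n k).GrowthLE m (m ^ (n * k)) :=
  isTame_itemPricing.growthLE hm fun S hS => hS ▸ encard_onSample_itemPricing S

theorem encard_onSample_anonymousBestPricing [NeZero n] (hk : 0 < k) (hS : 2 ≤ S.card * n) :
    ((anonymousBestPricing rule n k).onSample S).encard ≤ ((S.card * n) ^ (k + 1) : ℕ) :=
  encard_onSample_bestOf_le hS hk (encard_onSample_anonymousBundlePricing S)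
    (by simpa only [mul_comm] using encard_onSample_anonymousItemPricing S)

theorem encard_onSample_bestPricing (hn : 0 < n) (hk : 0 < k) (hS : 2 ≤ S.card) :
    ((bestPricing rule n k).onSample S).encard ≤ (S.card ^ (n * (k + 1)) : ℕ) := by
  rw [pow_mul]
  refine encard_onSample_bestOf_le (hS.trans (Nat.le_self_pow hn.ne' _)) hk
    (encard_onSample_bundlePricing S) ?_
  rw [← pow_mul]
  exact encard_onSample_itemPricing S

theorem growthLE_anonymousBestPricing [NeZero n] (hk : 0 < k) (hm : 0 < m) :
    (anonymousBestPricing rule n k).GrowthLE m ((m * n) ^ (k + 1)) := by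
  by_cases h : 2 ≤ m * n
  · refine isTame_anonymousBestPricing.growthLE hm fun S hS => ?_
    subst hS
    exact encard_onSample_anonymousBestPricing hk h
  · obtain ⟨rfl, rfl⟩ : m = 1 ∧ n = 1 :=
      mul_eq_one.1 (by have := Nat.mul_pos hm (NeZero.pos n); omega)
    simpa using growthLE_one _

theorem growthLE_bestPricing (hn : 0 < n) (hk : 0 < k) (hm : 0 < m) :
    (bestPricing rule n k).GrowthLE m (m ^ (n * (k + 1))) := by
  by_cases h : 2 ≤ m
  · refine isTame_bestPricing.growthLE hm fun S hS => ?_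
    subst hS
    exact encard_onSample_bestPricing hn hk h
  · obtain rfl : m = 1 := by omega
    simpa using growthLE_one _

end PricingClasses

end

noncomputable section

/-! ### Learning by empirical revenue maximization -/

variable {n k m : ℕ}

namespace AuctionClass

variable {A B : AuctionClass n k}

/-- The revenue of every auction of the class on the profile `v` lies in `[0, 1]`. A distribution
belongs to `A.unitRevenue` when almost every profile has this property. -/
def UnitRevenueAt (A : AuctionClass n k) (v : Profile n k) : Prop :=
  ∀ h, (A.mech h).revenue v ∈ Set.Icc (0 : ℝ) 1

theorem isMaximizer_map_iff (hm : 0 < m) {s : Fin m → Profile n k} {h : A.Hyp} :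
    A.IsMaximizer (univ.val.map s) h ↔
      ∀ h', ∑ t, (A.mech h').revenue (s t) ≤ ∑ t, (A.mech h).revenue (s t) := by
  have hemp (g : A.Hyp) :
      A.empRevenue (univ.val.map s) g = (∑ t, (A.mech g).revenue (s t)) / m := by
    simp only [empRevenue, Multiset.map_map, Multiset.card_map, card_val, card_univ,
      Fintype.card_fin]
    rfl
  simp only [IsMaximizer, hemp, div_le_div_iff_of_pos_right (Nat.cast_pos (α := ℝ) |>.2 hm)]

theorem map_univ_ne_zero (hm : 0 < m) (s : Fin m → Profile n k) : univ.val.map s ≠ 0 :=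
  Multiset.card_pos.1 (by simpa using hm)

theorem IsTame.exists_measurable_worst_maximizer (hA : A.IsTame) (D : Measure (Profile n k))
    [IsProbabilityMeasure D] (hm : 0 < m) :
    ∃ G : (Fin m → Profile n k) → A.Hyp,
      (Measurable fun p : (Fin m → Profile n k) × Profile n k => (A.mech (G p.1)).revenue p.2) ∧
      ∀ s, G s ∈ A.onSample (univ.val.map s) ∧ A.IsMaximizer (univ.val.map s) (G s) ∧
        ∀ h ∈ A.onSample (univ.val.map s), A.IsMaximizer (univ.val.map s) h →
          (A.mech (G s)).expRevenue D ≤ (A.mech h).expRevenue D := by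
  obtain ⟨Φ, _, hyp, hon, hmeas⟩ := hA.indexed m
  let : MeasurableSpace Φ := ⊤
  have hex (s : Fin m → Profile n k) : ∃ ψ, A.IsMaximizer (univ.val.map s) (hyp ψ s) := by
    obtain ⟨h, hh, hmax⟩ := hA.exists_isMaximizer _ (map_univ_ne_zero hm s)
    obtain ⟨ψ, rfl⟩ := hon s ▸ hh
    exact ⟨ψ, hmax⟩
  have : Nonempty Φ := (hex fun _ _ _ => 0).nonempty
  have hmax_iff (s : Fin m → Profile n k) (φ : Φ) : A.IsMaximizer (univ.val.map s) (hyp φ s) ↔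
      ∀ ψ, ∑ t, (A.mech (hyp ψ s)).revenue (s t) ≤ ∑ t, (A.mech (hyp φ s)).revenue (s t) := by
    obtain ⟨ψ, hψ⟩ := hex s
    rw [isMaximizer_map_iff hm] at hψ ⊢
    exact ⟨fun H _ => H _, fun H h => (hψ h).trans (H ψ)⟩
  have hsum (φ : Φ) : Measurable fun s => ∑ t, (A.mech (hyp φ s)).revenue (s t) :=
    measurable_sum _ fun t _ => (hmeas φ).comp (measurable_id.prodMk (measurable_pi_apply t))
  obtain ⟨sel, hsel, hmin⟩ := exists_measurable_argmin
    (M := fun φ => {s | A.IsMaximizer (univ.val.map s) (hyp φ s)})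
    (r := fun φ s => (A.mech (hyp φ s)).expRevenue D)
    (fun φ => by
      simp only [hmax_iff, Set.ofPred_forall]
      exact .iInter fun ψ => measurableSet_le (hsum ψ) (hsum φ))
    hex fun φ => (hmeas φ).stronglyMeasurable.integral_prod_right.measurable
  refine ⟨fun s => hyp (sel s) s, ?_, fun s => ⟨hon s ▸ ⟨_, rfl⟩, (hmin s).1, fun h hh hmax => ?_⟩⟩
  · exact (measurable_from_prod_countable_right (f := fun q : Φ × _ × _ =>
      (A.mech (hyp q.1 q.2.1)).revenue q.2.2) hmeas).comp
        ((hsel.comp measurable_fst).prodMk measurable_id)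
  · obtain ⟨ψ, rfl⟩ := hon s ▸ hh
    exact (hmin s).2 ψ hmax

section Expectation

variable {D : Measure (Profile n k)} [IsProbabilityMeasure D]
  (hD : ∀ᵐ v ∂D, A.UnitRevenueAt v)

include hD

theorem IsTame.integrable_revenue (hA : A.IsTame) (h : A.Hyp) :
    Integrable (A.mech h).revenue D :=
  .of_mem_Icc 0 1 (hA.measurable_revenue h).aemeasurable (hD.mono fun _ hv => hv h)

theorem expRevenue_mem_Icc (h : A.Hyp) : (A.mech h).expRevenue D ∈ Set.Icc (0 : ℝ) 1 := by
  refine ⟨integral_nonneg_of_ae (hD.mono fun v hv => (hv h).1), ?_⟩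
  calc (A.mech h).expRevenue D ≤ ∫ _, (1 : ℝ) ∂D :=
        integral_mono_of_nonneg (hD.mono fun v hv => (hv h).1) (integrable_const 1)
          (hD.mono fun v hv => (hv h).2)
    _ = 1 := by simp

theorem ae_forall_unitRevenueAt :
    ∀ᵐ s ∂(Measure.pi fun _ : Fin m => D), ∀ t, A.UnitRevenueAt (s t) :=
  ae_all_iff.2 fun t =>
    (measurePreserving_eval (fun _ : Fin m => D) t).quasiMeasurePreserving.ae hD

theorem integrable_uncurry_revenue {G : (Fin m → Profile n k) → A.Hyp}
    (hG : Measurable fun p : (Fin m → Profile n k) × Profile n k =>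
      (A.mech (G p.1)).revenue p.2) :
    Integrable (fun p : (Fin m → Profile n k) × Profile n k => (A.mech (G p.1)).revenue p.2)
      ((Measure.pi fun _ => D).prod D) :=
  .of_mem_Icc 0 1 hG.aemeasurable
    ((Measure.quasiMeasurePreserving_snd.ae hD).mono fun _ hp => hp _)

theorem integrable_revenue_sample {G : (Fin m → Profile n k) → A.Hyp}
    (hG : Measurable fun p : (Fin m → Profile n k) × Profile n k =>
      (A.mech (G p.1)).revenue p.2) (t : Fin m) :
    Integrable (fun s => (A.mech (G s)).revenue (s t)) (Measure.pi fun _ => D) :=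
  .of_mem_Icc 0 1 (hG.comp (measurable_id.prodMk (measurable_pi_apply t))).aemeasurable
    ((ae_forall_unitRevenueAt hD).mono fun _ hs => hs t _)

theorem IsTame.card_mul_expRevenue_le (hA : A.IsTame) (hm : 0 < m)
    {G : (Fin m → Profile n k) → A.Hyp}
    (hG : Measurable fun p : (Fin m → Profile n k) × Profile n k =>
      (A.mech (G p.1)).revenue p.2)
    (hmax : ∀ s, A.IsMaximizer (univ.val.map s) (G s)) (h : A.Hyp) :
    m * (A.mech h).expRevenue D ≤
      ∫ s, ∑ t, (A.mech (G s)).revenue (s t) ∂(Measure.pi fun _ => D) := by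
  have heval (t : Fin m) := measurePreserving_eval (fun _ : Fin m => D) t
  have hint := hA.integrable_revenue hD h
  calc m * (A.mech h).expRevenue D
      = ∑ t : Fin m, ∫ s, (A.mech h).revenue (s t) ∂(Measure.pi fun _ : Fin m => D) := by
        simp only [fun t => integral_comp_measurePreserving (heval t) hint.aestronglyMeasurable,
          sum_const, card_univ, Fintype.card_fin, nsmul_eq_mul, Mechanism.expRevenue]
    _ = ∫ s, ∑ t, (A.mech h).revenue (s t) ∂(Measure.pi fun _ : Fin m => D) :=
        (integral_finsetSum _ fun t _ => (heval t).integrable_comp_of_integrable hint).symm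
    _ ≤ _ := integral_mono
        (integrable_finsetSum _ fun t _ => (heval t).integrable_comp_of_integrable hint)
        (integrable_finsetSum _ fun t _ => integrable_revenue_sample hD hG t)
        fun s => (isMaximizer_map_iff hm).1 (hmax s) h

theorem ofReal_integral_expRevenue_le_learnedRevenue {erm : Multiset (Profile n k) → A.Hyp}
    {G : (Fin m → Profile n k) → A.Hyp}
    (hG : Measurable fun p : (Fin m → Profile n k) × Profile n k =>
      (A.mech (G p.1)).revenue p.2)
    (hle : ∀ s, (A.mech (G s)).expRevenue D ≤
      (A.mech (erm (univ.val.map s))).expRevenue D) :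
    ENNReal.ofReal (∫ s, (A.mech (G s)).expRevenue D ∂(Measure.pi fun _ => D)) ≤
      A.learnedRevenue erm D m := by
  have hint : Integrable (fun s => (A.mech (G s)).expRevenue D) (Measure.pi fun _ => D) :=
    (integrable_uncurry_revenue hD hG).integral_prod_left
  rw [ofReal_integral_eq_lintegral_ofReal hint
    (.of_forall fun s => (expRevenue_mem_Icc hD (G s)).1)]
  exact lintegral_mono fun s => ENNReal.ofReal_le_ofReal (hle s)

end Expectation

/-- On a double sample whose profiles have unit revenues, if for every choice of signs we take an
auction with prices from the sub-sample which the signs select, then its revenues on the two halves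
differ, in the direction of the signs, by at most `m * β` on average over the signs. -/
def SplitDeviationLE (A : AuctionClass n k) (m : ℕ) (β : ℝ) : Prop :=
  ∀ ω : Fin m → Profile n k × Profile n k,
    (∀ t, A.UnitRevenueAt (ω t).1) → (∀ t, A.UnitRevenueAt (ω t).2) →
    ∀ h : (Fin m → ℤˣ) → A.Hyp,
      (∀ σ, h σ ∈ A.onSample (univ.val.map (firstHalf (swapPairs σ ω)))) →
      𝔼 σ, signedSum σ (fun t =>
        (A.mech (h σ)).revenue (ω t).1 - (A.mech (h σ)).revenue (ω t).2) ≤ m * β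

theorem IsTame.optRevenue_le_of_splitDeviationLE (hA : A.IsTame)
    {erm : Multiset (Profile n k) → A.Hyp} (herm : A.IsERM erm)
    {D : ProbabilityMeasure (Profile n k)} (hD : D ∈ A.unitRevenue) (hm : 0 < m) {β : ℝ}
    (hβ : A.SplitDeviationLE m β) :
    ENNReal.ofReal (A.optRevenue D) ≤ A.learnedRevenue erm D m + ENNReal.ofReal β := by
  have hunit : ∀ᵐ v ∂(D : Measure (Profile n k)), A.UnitRevenueAt v := hD
  obtain ⟨G, hG, hworst⟩ :=
    hA.exists_measurable_worst_maximizer (m := m) (D : Measure (Profile n k)) hm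
  have hdev : ∀ᵐ ω ∂(Measure.pi fun _ : Fin m => (D : Measure (Profile n k)).prod
      (D : Measure (Profile n k))),
      𝔼 σ, deviation (fun s v => (A.mech (G s)).revenue v) (swapPairs σ ω) ≤ m * β := by
    have heval (t : Fin m) := (measurePreserving_eval (fun _ : Fin m =>
      (D : Measure (Profile n k)).prod (D : Measure (Profile n k))) t).quasiMeasurePreserving
    filter_upwards [
      ae_all_iff.2 fun t => (heval t).ae (Measure.quasiMeasurePreserving_fst.ae hunit),
      ae_all_iff.2 fun t => (heval t).ae (Measure.quasiMeasurePreserving_snd.ae hunit)] with ω h₁ h₂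
    simp only [deviation_swapPairs]
    exact hβ ω h₁ h₂ (fun σ => G (firstHalf (swapPairs σ ω))) fun σ => (hworst _).1
  have hsymm := integral_sum_le_of_expect_deviation_le (integrable_uncurry_revenue hunit hG)
    (integrable_revenue_sample hunit hG) hdev
  have hopt (h : A.Hyp) : (A.mech h).expRevenue D ≤
      ∫ s, (A.mech (G s)).expRevenue D ∂(Measure.pi fun _ => (D : Measure (Profile n k))) + β := by
    have hm' : (0 : ℝ) < m := Nat.cast_pos.2 hm
    have := (hA.card_mul_expRevenue_le hunit hm hG (fun s => (hworst s).2.1) h).trans hsymm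
    rw [Fintype.card_fin, ← mul_add] at this
    exact le_of_mul_le_mul_left this hm'
  have hlearn := ofReal_integral_expRevenue_le_learnedRevenue (erm := erm) hunit hG fun s =>
    (hworst s).2.2 _ (hA.ermOnSample.2 erm herm _ (map_univ_ne_zero hm s))
      (herm.isMaximizer _ (map_univ_ne_zero hm s))
  have : Nonempty A.Hyp := ⟨erm 0⟩
  calc ENNReal.ofReal (A.optRevenue D) ≤ _ := ENNReal.ofReal_le_ofReal (ciSup_le hopt)
    _ ≤ _ := ENNReal.ofReal_add_le.trans (by gcongr)

theorem IsTame.onSample_swapPairs_subset (hA : A.IsTame) (σ : Fin m → ℤˣ)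
    (ω : Fin m → Profile n k × Profile n k) :
    A.onSample (univ.val.map (firstHalf (swapPairs σ ω))) ⊆
      A.onSample (univ.val.map (fun t => (ω t).1) + univ.val.map fun t => (ω t).2) := by
  refine hA.onSample_mono fun v hv => ?_
  obtain ⟨t, -, rfl⟩ := Multiset.mem_map.1 hv
  rw [Multiset.mem_add]
  rcases Int.units_eq_one_or (σ t) with hσ | hσ
  · exact .inl (Multiset.mem_map.2 ⟨t, mem_univ_val t, by simp [firstHalf, swapPairs, hσ]⟩)
  · exact .inr (Multiset.mem_map.2 ⟨t, mem_univ_val t, by simp [firstHalf, swapPairs, hσ]⟩)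

theorem IsTame.splitDeviationLE_of_encard (hA : A.IsTame) {N : ℕ} (hN : 2 ≤ N)
    (hcard : ∀ S : Multiset (Profile n k), S.card = 2 * m → (A.onSample S).encard ≤ N) :
    A.SplitDeviationLE m √(2 * Real.log N / m) := by
  classical
  rcases Nat.eq_zero_or_pos m with rfl | hm
  · intro ω _ _ h _
    simp [signedSum_apply]
  intro ω h₁ h₂ h hh
  set S : Multiset (Profile n k) := univ.val.map (fun t => (ω t).1) + univ.val.map fun t => (ω t).2
  have hS : S.card = 2 * m := by simp [S, two_mul]
  have hfin : (A.onSample S).Finite := Set.finite_of_encard_le_coe (hcard S hS)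
  let a (g : A.Hyp) (t : Fin m) : ℝ := (A.mech g).revenue (ω t).1 - (A.mech g).revenue (ω t).2
  have hV : (#(hfin.toFinset.image a) : ℝ) ≤ Real.exp (Real.log N) := by
    rw [Real.exp_log (by positivity)]
    have := hcard S hS
    rw [hfin.encard_eq_coe_toFinset_card] at this
    exact_mod_cast card_image_le.trans (by exact_mod_cast this)
  have hW : ∀ b ∈ hfin.toFinset.image a, ∑ t, b t ^ 2 ≤ (m : ℝ) := by
    refine forall_mem_image.2 fun g _ => ?_
    have hle (t : Fin m) : a g t ^ 2 ≤ 1 := by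
      rw [sq_le_one_iff_abs_le_one]
      exact abs_sub_le_of_nonneg_of_le (h₁ t g).1 (h₁ t g).2 (h₂ t g).1 (h₂ t g).2
    simpa using sum_le_sum fun t (_ : t ∈ univ) => hle t
  have hlog : 0 < Real.log N := Real.log_pos (by exact_mod_cast hN)
  have hc : 0 < √(2 * Real.log N / m) := by positivity
  have hsq : √(2 * Real.log N / m) ^ 2 = 2 * Real.log N / m := Real.sq_sqrt (by positivity)
  refine (expect_signedSum_le_of_card_le_exp _ hV hW hc (fun σ => a (h σ)) fun σ =>
    mem_image_of_mem _ (hfin.mem_toFinset.2 (hA.onSample_swapPairs_subset σ ω (hh σ)))).trans_eq ?_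
  rw [div_eq_iff hc.ne', mul_assoc, ← sq, hsq]
  field

/-- The Rademacher average of the class is at most `β` on every sample of `m` profiles with unit
revenues: no choice of auctions correlates with random signs beyond `m * β`. -/
def RademacherLE (A : AuctionClass n k) (m : ℕ) (β : ℝ) : Prop :=
  ∀ z : Fin m → Profile n k, (∀ t, A.UnitRevenueAt (z t)) → ∀ h : (Fin m → ℤˣ) → A.Hyp,
    𝔼 σ, signedSum σ (fun t => (A.mech (h σ)).revenue (z t)) ≤ m * β

theorem RademacherLE.splitDeviationLE {β : ℝ} (hβ : A.RademacherLE m β) :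
    A.SplitDeviationLE m (2 * β) := by
  intro ω h₁ h₂ h _
  have hneg : 𝔼 σ : Fin m → ℤˣ, -signedSum σ (fun t => (A.mech (h σ)).revenue (ω t).2) =
      𝔼 σ : Fin m → ℤˣ, signedSum σ fun t => (A.mech (h (-σ))).revenue (ω t).2 :=
    Fintype.expect_equiv (Equiv.neg _) _ _ fun σ => by
      simp only [Equiv.neg_apply, neg_neg, signedSum_neg]
  calc 𝔼 σ, signedSum σ (fun t =>
        (A.mech (h σ)).revenue (ω t).1 - (A.mech (h σ)).revenue (ω t).2)
      = 𝔼 σ, signedSum σ (fun t => (A.mech (h σ)).revenue (ω t).1) +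
          𝔼 σ, signedSum σ (fun t => (A.mech (h (-σ))).revenue (ω t).2) := by
        rw [← hneg, ← expect_add_distrib]
        exact expect_congr rfl fun σ _ => (map_sub (signedSum σ) _ _).trans (sub_eq_add_neg _ _)
    _ ≤ m * β + m * β := add_le_add (hβ _ h₁ h) (hβ _ h₂ fun σ => h (-σ))
    _ = m * (2 * β) := by ring

theorem RademacherLE.bestOf {α β : ℝ} (hA : A.RademacherLE m α) (hB : B.RademacherLE m β)
    (hA0 : ∃ h, ∀ v, A.UnitRevenueAt v → (A.mech h).revenue v = 0)
    (hB0 : ∃ h, ∀ v, B.UnitRevenueAt v → (B.mech h).revenue v = 0) :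
    (bestOf A B).RademacherLE m (α + β) := by
  obtain ⟨a, ha⟩ := hA0
  obtain ⟨b, hb⟩ := hB0
  intro z hz h
  have hzA (t : Fin m) : A.UnitRevenueAt (z t) := fun g => hz t (Sum.inl g)
  have hzB (t : Fin m) : B.UnitRevenueAt (z t) := fun g => hz t (Sum.inr g)
  -- The missing summand of `h σ` is filled up with an auction that earns nothing.
  let left (σ : Fin m → ℤˣ) : A.Hyp := Sum.elim id (fun _ => a) (h σ)
  let right (σ : Fin m → ℤˣ) : B.Hyp := Sum.elim (fun _ => b) id (h σ)
  have hsplit (σ : Fin m → ℤˣ) (t : Fin m) : ((SplitSample.bestOf A B).mech (h σ)).revenue (z t) =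
      (A.mech (left σ)).revenue (z t) + (B.mech (right σ)).revenue (z t) := by
    rcases hσ : h σ with g | g
    · simp [left, right, hσ, hb _ (hzB t), SplitSample.bestOf]
    · simp [left, right, hσ, ha _ (hzA t), SplitSample.bestOf]
  calc 𝔼 σ, signedSum σ (fun t => ((SplitSample.bestOf A B).mech (h σ)).revenue (z t))
      = 𝔼 σ, signedSum σ (fun t => (A.mech (left σ)).revenue (z t)) +
          𝔼 σ, signedSum σ (fun t => (B.mech (right σ)).revenue (z t)) := by
        rw [← expect_add_distrib]
        exact expect_congr rfl fun σ _ =>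
          (congrArg _ (funext (hsplit σ))).trans (map_add (signedSum σ) _ _)
    _ ≤ m * α + m * β := add_le_add (hA z hzA left) (hB z hzB right)
    _ = m * (α + β) := by ring

end AuctionClass

end

noncomputable section

/-! ### Sample complexity -/

variable {n k m : ℕ} {rule : SaleRule}

namespace SeparateSale

variable {Pool Good : Type} [Fintype Good] {A : AuctionClass n k} {pool : Fin n → Pool}
  {bid : Good → Profile n k → Fin n → ℝ≥0}

theorem sum_sup_bid_le_one (P : SeparateSale rule A pool bid) {v : Profile n k}
    (hv : A.UnitRevenueAt v) : ∑ j, univ.sup (bid j v) ≤ 1 := by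
  have hrev := (hv (P.price.symm fun _ j => univ.sup (bid j v))).2
  rw [P.revenue_eq, ← NNReal.coe_sum, NNReal.coe_le_one, P.price.apply_symm_apply] at hrev
  exact (sum_le_sum fun j _ => sup_le_goodRevenue rule (bid j v)).trans hrev

theorem sup_bid_le_one (P : SeparateSale rule A pool bid) {v : Profile n k}
    (hv : A.UnitRevenueAt v) (j : Good) : univ.sup (bid j v) ≤ 1 :=
  (single_le_sum_of_canonicallyOrdered (mem_univ j)).trans (P.sum_sup_bid_le_one hv)

theorem exists_revenue_eq_zero (P : SeparateSale rule A pool bid) :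
    ∃ h, ∀ v, A.UnitRevenueAt v → (A.mech h).revenue v = 0 := by
  refine ⟨P.price.symm fun _ _ => 2, fun v hv => ?_⟩
  rw [P.revenue_eq, P.price.apply_symm_apply]
  refine sum_eq_zero fun j _ => ?_
  rw [goodRevenue_eq_zero fun i => ?_, NNReal.coe_zero]
  exact ((le_sup (mem_univ i)).trans (P.sup_bid_le_one hv j)).trans_lt one_lt_two

theorem rademacherLE (P : SeparateSale rule A pool bid) {δ : ℝ} (hδ : 0 < δ)
    (hlog : 1 / 2 ≤ Real.log (1 / δ))
    (hm : n * Fintype.card Good * Real.log (1 / δ) ≤ m * δ ^ 2) :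
    A.RademacherLE m (176 * δ) := by
  intro z hz h
  -- Each good gets its own share of the total of the values, and an equal share of `m` on top.
  let M (j : Good) : ℝ := ∑ t, ((univ.sup (bid j (z t)) : ℝ≥0) : ℝ) + m / Fintype.card Good
  have hgood (j : Good) : 𝔼 σ : Fin m → ℤˣ, signedSum σ (fun t =>
      (goodRevenue rule (fun i => P.price (h σ) (pool i) j) (bid j (z t)) : ℝ)) ≤
      88 * δ * M j := by
    have hcard : 0 < (Fintype.card Good : ℝ) := Nat.cast_pos.2 (Fintype.card_pos_iff.2 ⟨j⟩)
    have hshare : n * Real.log (1 / δ) ≤ m / Fintype.card Good * δ ^ 2 := by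
      rw [div_mul_eq_mul_div, le_div_iff₀ hcard]
      linarith
    have hshare_le : (m / Fintype.card Good : ℝ) ≤ M j := le_add_of_nonneg_left (by positivity)
    exact expect_signedSum_goodRevenue_le hδ hlog (hshare.trans (by gcongr))
      (le_add_of_nonneg_right (by positivity)) (fun t => P.sup_bid_le_one (hz t) j) _
  have hM : ∑ j, M j ≤ m + m := by
    rw [sum_add_distrib, sum_comm]
    refine add_le_add ?_ ?_
    · calc ∑ t, ∑ j, ((univ.sup (bid j (z t)) : ℝ≥0) : ℝ) ≤ ∑ _t : Fin m, (1 : ℝ) :=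
            sum_le_sum fun t _ => by exact_mod_cast P.sum_sup_bid_le_one (hz t)
        _ = m := by simp
    · rw [sum_const, card_univ, nsmul_eq_mul]
      exact (mul_div_left_comm _ _ _).trans_le
        (mul_le_of_le_one_right (by positivity) (div_self_le_one _))
  calc 𝔼 σ, signedSum σ (fun t => (A.mech (h σ)).revenue (z t))
      = ∑ j, 𝔼 σ : Fin m → ℤˣ, signedSum σ (fun t =>
          (goodRevenue rule (fun i => P.price (h σ) (pool i) j) (bid j (z t)) : ℝ)) := by
        rw [← expect_sum_comm]
        refine expect_congr rfl fun σ _ => ?_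
        simp only [P.revenue_eq, ← map_sum, sum_fn]
    _ ≤ ∑ j, 88 * δ * M j := sum_le_sum fun j _ => hgood j
    _ = 88 * δ * ∑ j, M j := by rw [mul_sum]
    _ ≤ 88 * δ * (m + m) := by gcongr
    _ = m * (176 * δ) := by ring

end SeparateSale

section Complexity

variable {A B : AuctionClass n k} {x ε : ℝ}

theorem mul_log_div_le (hx : 0 ≤ x) (hε : 0 < ε) (hε2 : ε ≤ 1 / 2) :
    x * Real.log (1 / (ε / 704)) ≤ 5500000 * (x * Real.log (1 / ε) / ε ^ 2) * (ε / 704) ^ 2 := by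
  have hinv : 2 ≤ 1 / ε := by
    rw [le_div_iff₀ hε]
    linarith
  have hlog704 : Real.log 704 ≤ 10 * Real.log (1 / ε) := by
    calc Real.log 704 ≤ Real.log ((1 / ε) ^ 10) := Real.log_le_log (by norm_num) (by
          calc (704 : ℝ) ≤ 2 ^ 10 := by norm_num
            _ ≤ (1 / ε) ^ 10 := by gcongr)
      _ = 10 * Real.log (1 / ε) := by rw [Real.log_pow, Nat.cast_ofNat]
  have hlog : Real.log (1 / (ε / 704)) = Real.log 704 + Real.log (1 / ε) := by
    rw [← Real.log_mul (by norm_num) (by positivity)]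
    congr 1
    field
  have hnonneg : 0 ≤ x * Real.log (1 / ε) := mul_nonneg hx (Real.log_nonneg (by linarith))
  calc x * Real.log (1 / (ε / 704)) = x * (Real.log 704 + Real.log (1 / ε)) := by rw [hlog]
    _ ≤ x * (11 * Real.log (1 / ε)) := by
        gcongr
        linarith
    _ ≤ 5500000 / 704 ^ 2 * (x * Real.log (1 / ε)) := by linarith
    _ = 5500000 * (x * Real.log (1 / ε) / ε ^ 2) * (ε / 704) ^ 2 := by field

/-- Symmetrization doubles the Rademacher averages, so that `δ = ε / 704` gives accuracy `ε`. -/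
theorem AuctionClass.IsTame.complexityLE (hA : A.IsTame) (hx : 1 ≤ x)
    (hrad : ∀ (m : ℕ) (δ : ℝ), 0 < δ → 1 / 2 ≤ Real.log (1 / δ) →
      x * Real.log (1 / δ) ≤ m * δ ^ 2 → A.RademacherLE m (352 * δ))
    (hε : 0 < ε) (hε2 : ε ≤ 1 / 2) :
    A.ComplexityLE ε (6000000 * (x * Real.log (1 / ε) / ε ^ 2)) := by
  intro erm herm
  set X := x * Real.log (1 / ε) / ε ^ 2 with hX
  have hlog_half {y : ℝ} (hy : 0 < y) (hy2 : y ≤ 1 / 2) : 1 / 2 ≤ Real.log (1 / y) := by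
    have hinv : 2 ≤ 1 / y := by
      rw [le_div_iff₀ hy]
      linarith
    linarith [Real.log_le_log two_pos hinv, Real.log_two_gt_d9]
  have hX1 : 1 ≤ X := by
    rw [hX, le_div_iff₀ (by positivity)]
    nlinarith [hlog_half hε hε2]
  have hcomplexity : A.sampleComplexity erm A.unitRevenue ε ≤ ⌈5500000 * X⌉₊ := by
    refine sInf_le ⟨_, rfl, fun m hm D hD => ?_⟩
    have hm' : 5500000 * X ≤ m := Nat.ceil_le.1 hm
    have hm0 : 0 < m := Nat.cast_pos (α := ℝ) |>.1 (by linarith)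
    have hδ := hrad m (ε / 704) (by positivity) (hlog_half (by positivity) (by linarith))
      ((mul_log_div_le (by linarith) hε hε2).trans (by gcongr))
    have hopt := hA.optRevenue_le_of_splitDeviationLE herm hD hm0 hδ.splitDeviationLE
    rwa [show 2 * (352 * (ε / 704)) = ε by ring] at hopt
  calc (A.sampleComplexity erm A.unitRevenue ε : ℝ≥0∞)
      ≤ ((⌈5500000 * X⌉₊ : ℕ∞) : ℝ≥0∞) := ENat.toENNReal_le.2 hcomplexity
    _ = ENNReal.ofReal ⌈5500000 * X⌉₊ := by simp
    _ ≤ ENNReal.ofReal (6000000 * X) := by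
        gcongr
        linarith [Nat.ceil_lt_add_one (a := 5500000 * X) (by linarith)]

namespace SeparateSale

variable {Pool Good Pool' Good' : Type} [Finite Pool] [Fintype Good] [Finite Pool']
  [Fintype Good'] {pool : Fin n → Pool} {bid : Good → Profile n k → Fin n → ℝ≥0}
  {pool' : Fin n → Pool'} {bid' : Good' → Profile n k → Fin n → ℝ≥0}

theorem complexityLE (P : SeparateSale rule A pool bid) (hx : 1 ≤ x)
    (hP : n * Fintype.card Good ≤ x) (hε : 0 < ε) (hε2 : ε ≤ 1 / 2) :
    A.ComplexityLE ε (6000000 * (x * Real.log (1 / ε) / ε ^ 2)) := by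
  refine P.isTame.complexityLE hx (fun m δ hδ hlog hm z hz h => ?_) hε hε2
  calc 𝔼 σ, signedSum σ (fun t => (A.mech (h σ)).revenue (z t)) ≤ m * (176 * δ) :=
        P.rademacherLE hδ hlog (le_trans (by gcongr) hm) z hz h
    _ ≤ m * (352 * δ) := by
        gcongr
        norm_num

theorem complexityLE_bestOf (P : SeparateSale rule A pool bid) (Q : SeparateSale rule B pool' bid')
    (hx : 1 ≤ x) (hP : n * Fintype.card Good ≤ x) (hQ : n * Fintype.card Good' ≤ x) (hε : 0 < ε)
    (hε2 : ε ≤ 1 / 2) :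
    (bestOf A B).ComplexityLE ε (6000000 * (x * Real.log (1 / ε) / ε ^ 2)) := by
  refine (P.isTame.bestOf Q.isTame).complexityLE hx (fun m δ hδ hlog hm => ?_) hε hε2
  rw [show 352 * δ = 176 * δ + 176 * δ by ring]
  exact (P.rademacherLE hδ hlog (le_trans (by gcongr) hm)).bestOf
    (Q.rademacherLE hδ hlog (le_trans (by gcongr) hm)) P.exists_revenue_eq_zero
    Q.exists_revenue_eq_zero

end SeparateSale

end Complexity

section PricingClasses

variable {ε : ℝ} (hε : 0 < ε) (hε2 : ε ≤ 1 / 2)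
include hε hε2

theorem complexityLE_anonymousBundlePricing [NeZero n] :
    (anonymousBundlePricing rule n k).ComplexityLE ε
      (6000000 * (n * Real.log (1 / ε) / ε ^ 2)) :=
  anonymousBundleSale.complexityLE (mod_cast NeZero.one_le) (by simp) hε hε2

theorem complexityLE_bundlePricing (hn : 0 < n) :
    (bundlePricing rule n k).ComplexityLE ε (6000000 * (n * Real.log (1 / ε) / ε ^ 2)) :=
  bundleSale.complexityLE (mod_cast hn) (by simp) hε hε2

theorem complexityLE_anonymousItemPricing [NeZero n] (hk : 0 < k) :
    (anonymousItemPricing rule n k).ComplexityLE ε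
      (6000000 * (n * k * Real.log (1 / ε) / ε ^ 2)) :=
  anonymousItemSale.complexityLE (mod_cast Nat.mul_pos (NeZero.pos n) hk) (by simp) hε hε2

theorem complexityLE_itemPricing (hn : 0 < n) (hk : 0 < k) :
    (itemPricing rule n k).ComplexityLE ε (6000000 * (n * k * Real.log (1 / ε) / ε ^ 2)) :=
  itemSale.complexityLE (mod_cast Nat.mul_pos hn hk) (by simp) hε hε2

theorem complexityLE_anonymousBestPricing [NeZero n] :
    (anonymousBestPricing rule n k).ComplexityLE ε
      (6000000 * (n * (k + 1) * Real.log (1 / ε) / ε ^ 2)) :=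
  anonymousBundleSale.complexityLE_bestOf anonymousItemSale
    (mod_cast Nat.mul_pos (NeZero.pos n) k.succ_pos) (by simp [mul_add, mul_nonneg])
    (by simp [mul_add]) hε hε2

theorem complexityLE_bestPricing (hn : 0 < n) :
    (bestPricing rule n k).ComplexityLE ε
      (6000000 * (n * (k + 1) * Real.log (1 / ε) / ε ^ 2)) :=
  bundleSale.complexityLE_bestOf itemSale
    (mod_cast Nat.mul_pos hn k.succ_pos) (by simp [mul_add, mul_nonneg])
    (by simp [mul_add]) hε hε2

end PricingClasses

end

noncomputable section

/-! ### Selling one good to one bidder -/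

/-- The revenue of the best take-it-or-leave-it price for a bidder whose value has distribution
`μ`. -/
def postedRevenue (μ : Measure ℝ≥0) : ℝ≥0∞ := ⨆ y : ℝ≥0, y * μ (Set.Ici y)

theorem mul_measure_Ici_le_postedRevenue (μ : Measure ℝ≥0) (y : ℝ≥0) :
    y * μ (Set.Ici y) ≤ postedRevenue μ :=
  le_iSup (fun y : ℝ≥0 => (y : ℝ≥0∞) * μ (Set.Ici y)) y

theorem add_mul_measure_Ici_le_postedRevenue_add (μ : Measure ℝ≥0) [IsProbabilityMeasure μ]
    (y h : ℝ≥0) : (y + h : ℝ≥0) * μ (Set.Ici y) ≤ postedRevenue μ + h := by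
  rw [ENNReal.coe_add, add_mul]
  exact add_le_add (mul_measure_Ici_le_postedRevenue μ y) (mul_le_of_le_one_right' prob_le_one)

/-- A truthful mechanism that sells one good to one bidder: a bidder who reports `v` receives the
good with probability `x v` and pays `p v`. -/
structure IsTruthfulOneGood (x p : ℝ≥0 → ℝ) : Prop where
  alloc_nonneg : ∀ v, 0 ≤ x v
  alloc_le_one : ∀ v, x v ≤ 1
  incentive_compatible : ∀ v w : ℝ≥0, v * x w - p w ≤ v * x v - p v
  individually_rational : ∀ v : ℝ≥0, 0 ≤ v * x v - p v

theorem exists_grid_cell (θ v : ℝ≥0) {h : ℝ≥0} (hh : 0 < h) :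
    ∃ N : ℕ, v ≤ θ + N * h ∧ ∀ l < N, θ + l * h ≤ v := by
  classical
  have hex : ∃ N : ℕ, v ≤ θ + N * h := by
    obtain ⟨N, hN⟩ := exists_nat_ge (v / h)
    exact ⟨N, ((div_le_iff₀ hh).1 hN).trans le_add_self⟩
  exact ⟨Nat.find hex, Nat.find_spec hex, fun l hl => (not_le.1 (Nat.find_min hex hl)).le⟩

namespace IsTruthfulOneGood

variable {x p : ℝ≥0 → ℝ}

theorem monotone_alloc (H : IsTruthfulOneGood x p) : Monotone x := by
  intro v w hvw
  rcases hvw.eq_or_lt with rfl | hlt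
  · exact le_rfl
  · have hgain : 0 ≤ ((w : ℝ) - v) * (x w - x v) := by
      linarith [H.incentive_compatible v w, H.incentive_compatible w v]
    exact sub_nonneg.1 (nonneg_of_mul_nonneg_right hgain (sub_pos.2 (by exact_mod_cast hlt)))

theorem pay_sub_pay_le (H : IsTruthfulOneGood x p) (v w : ℝ≥0) :
    p w - p v ≤ w * (x w - x v) := by
  linarith [H.incentive_compatible w v]

theorem monotone_pay (H : IsTruthfulOneGood x p) : Monotone p := by
  intro v w hvw
  have hdev := H.incentive_compatible v w
  have hx := mul_le_mul_of_nonneg_left (H.monotone_alloc hvw) v.coe_nonneg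
  linarith

theorem pay_le_sum (H : IsTruthfulOneGood x p) (z : ℕ → ℝ≥0) (N : ℕ) :
    p (z N) ≤ z 0 * x (z 0) + ∑ l ∈ range N, z (l + 1) * (x (z (l + 1)) - x (z l)) := by
  induction N with
  | zero => simpa using H.individually_rational (z 0)
  | succ N ih =>
    rw [sum_range_succ]
    linarith [H.pay_sub_pay_le (z N) (z (N + 1))]

/-- On the grid `θ, θ + h, θ + 2h, …`, the payment of a bidder with a value of at least `θ` is at
most a nonnegative combination of posted prices. -/
theorem indicator_ofReal_pay_le (H : IsTruthfulOneGood x p) (θ : ℝ≥0) {h : ℝ≥0} (hh : 0 < h)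
    (v : ℝ≥0) :
    (Set.Ici θ).indicator (fun v => ENNReal.ofReal (p v)) v ≤
      (Set.Ici θ).indicator (fun _ => ENNReal.ofReal (θ * x θ)) v +
        ∑' l : ℕ, (Set.Ici (θ + l * h)).indicator (fun _ => (θ + l * h + h : ℝ≥0) *
          ENNReal.ofReal (x (θ + (l + 1 : ℕ) * h) - x (θ + l * h))) v := by
  by_cases hv : v ∈ Set.Ici θ
  swap
  · simp [hv]
  obtain ⟨N, hvN, hgrid⟩ := exists_grid_cell θ v hh
  rw [Set.indicator_of_mem hv, Set.indicator_of_mem hv]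
  have hpay : p v ≤ θ * x θ + ∑ l ∈ range N, (θ + l * h + h : ℝ≥0) *
      (x (θ + (l + 1 : ℕ) * h) - x (θ + l * h)) := by
    refine (H.monotone_pay hvN).trans ((H.pay_le_sum (fun l => θ + l * h) N).trans_eq ?_)
    simp only [Nat.cast_zero, zero_mul, add_zero, Nat.cast_add_one, add_mul, one_mul, add_assoc]
  refine (ENNReal.ofReal_le_ofReal hpay).trans (ENNReal.ofReal_add_le.trans ?_)
  gcongr
  refine le_trans ?_ (ENNReal.sum_le_tsum (range N))
  rw [ENNReal.ofReal_sum_of_nonneg fun l _ => mul_nonneg (NNReal.coe_nonneg _)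
    (sub_nonneg.2 (H.monotone_alloc (by gcongr; omega)))]
  refine sum_le_sum fun l hl => ?_
  rw [Set.indicator_of_mem (Set.mem_Ici.2 (hgrid l (mem_range.1 hl))),
    ENNReal.ofReal_mul (NNReal.coe_nonneg _), ENNReal.ofReal_coe_nnreal]

theorem ofReal_alloc_add_tsum_le_one (H : IsTruthfulOneGood x p) {z : ℕ → ℝ≥0}
    (hz : Monotone z) :
    ENNReal.ofReal (x (z 0)) + ∑' l, ENNReal.ofReal (x (z (l + 1)) - x (z l)) ≤ 1 := by
  rw [ENNReal.tsum_eq_iSup_nat, ENNReal.add_iSup]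
  refine iSup_le fun N => ?_
  have hstep : ∀ l, 0 ≤ x (z (l + 1)) - x (z l) := fun l =>
    sub_nonneg.2 (H.monotone_alloc (hz l.le_succ))
  rw [← ENNReal.ofReal_sum_of_nonneg fun l _ => hstep l, sum_range_sub fun l => x (z l),
    ← ENNReal.ofReal_add (H.alloc_nonneg _)
      (sub_nonneg.2 (H.monotone_alloc (hz N.zero_le))), add_sub_cancel]
  exact ENNReal.ofReal_le_one.2 (H.alloc_le_one _)

theorem setLIntegral_pay_le (H : IsTruthfulOneGood x p) (μ : Measure ℝ≥0)
    [IsProbabilityMeasure μ] (θ : ℝ≥0) :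
    ∫⁻ v in Set.Ici θ, ENNReal.ofReal (p v) ∂μ ≤ postedRevenue μ := by
  refine ENNReal.le_of_forall_pos_le_add fun h hh _ => ?_
  set z : ℕ → ℝ≥0 := fun l => θ + l * h with hz
  have hzmono : Monotone z := fun l l' hl => by
    simp only [hz]
    gcongr
  have hz0 : z 0 = θ := by simp [hz]
  calc ∫⁻ v in Set.Ici θ, ENNReal.ofReal (p v) ∂μ
      ≤ ∫⁻ v, ((Set.Ici θ).indicator (fun _ => ENNReal.ofReal (θ * x θ)) v +
          ∑' l, (Set.Ici (z l)).indicator (fun _ => (z l + h : ℝ≥0) *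
            ENNReal.ofReal (x (z (l + 1)) - x (z l))) v) ∂μ := by
        rw [← lintegral_indicator measurableSet_Ici]
        exact lintegral_mono (H.indicator_ofReal_pay_le θ hh)
    _ = ENNReal.ofReal (θ * x θ) * μ (Set.Ici θ) + ∑' l, ((z l + h : ℝ≥0) *
          ENNReal.ofReal (x (z (l + 1)) - x (z l))) * μ (Set.Ici (z l)) := by
        rw [lintegral_add_left (measurable_const.indicator measurableSet_Ici),
          lintegral_tsum fun l => (measurable_const.indicator measurableSet_Ici).aemeasurable]
        simp only [lintegral_indicator_const measurableSet_Ici]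
    _ ≤ ENNReal.ofReal (x θ) * (postedRevenue μ + h) +
          ∑' l, ENNReal.ofReal (x (z (l + 1)) - x (z l)) * (postedRevenue μ + h) := by
        refine add_le_add ?_ (ENNReal.tsum_le_tsum fun l => ?_)
        · rw [ENNReal.ofReal_mul θ.coe_nonneg, ENNReal.ofReal_coe_nnreal, mul_comm (θ : ℝ≥0∞),
            mul_assoc]
          gcongr
          exact (mul_measure_Ici_le_postedRevenue μ θ).trans le_self_add
        · rw [mul_comm ((z l + h : ℝ≥0) : ℝ≥0∞), mul_assoc]
          gcongr
          exact add_mul_measure_Ici_le_postedRevenue_add μ _ h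
    _ = (ENNReal.ofReal (x (z 0)) + ∑' l, ENNReal.ofReal (x (z (l + 1)) - x (z l))) *
          (postedRevenue μ + h) := by
        rw [ENNReal.tsum_mul_right, ← add_mul, hz0]
    _ ≤ postedRevenue μ + h := mul_le_of_le_one_left' (H.ofReal_alloc_add_tsum_le_one hzmono)

end IsTruthfulOneGood

/-! ### Truncated values -/

/-- The value `v` if it lies below the threshold `R`, and `0` otherwise. -/
def truncation (R v : ℝ≥0) : ℝ≥0 := if v < R then v else 0

theorem truncation_le_threshold (R v : ℝ≥0) : truncation R v ≤ R := by
  unfold truncation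
  split_ifs with h
  exacts [h.le, zero_le]

theorem truncation_le_self (R v : ℝ≥0) : truncation R v ≤ v := by
  unfold truncation
  split_ifs
  exacts [le_rfl, zero_le]

@[fun_prop]
theorem measurable_truncation (R : ℝ≥0) : Measurable (truncation R) :=
  Measurable.ite measurableSet_Iio measurable_id measurable_const

theorem measure_le_truncation_mul_le (μ : Measure ℝ≥0) (R : ℝ≥0) {t : ℝ} (ht : 0 < t) :
    μ {v | t ≤ truncation R v} * ENNReal.ofReal t ≤
      (Set.Iio (R : ℝ)).indicator (fun _ => postedRevenue μ) t := by
  have hsub : {v | t ≤ truncation R v} ⊆ Set.Ici t.toNNReal := fun v hv => by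
    rw [Set.mem_Ici, Real.toNNReal_le_iff_le_coe]
    exact le_trans hv (NNReal.coe_le_coe.2 (truncation_le_self R v))
  by_cases htR : t < R
  · rw [Set.indicator_of_mem (Set.mem_Iio.2 htR), mul_comm]
    exact le_trans (by gcongr; rfl) (mul_measure_Ici_le_postedRevenue μ t.toNNReal)
  · have hempty : {v | t ≤ truncation R v} = ∅ := Set.eq_empty_of_forall_notMem fun v hv => by
      have hv' : t ≤ truncation R v := hv
      unfold truncation at hv'
      split_ifs at hv' with hvR
      · exact htR (hv'.trans_lt (NNReal.coe_lt_coe.2 hvR))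
      · exact ht.not_ge hv'
    simp [hempty]

theorem lintegral_sq_truncation_le (μ : Measure ℝ≥0) (R : ℝ≥0) :
    ∫⁻ v, ENNReal.ofReal ((truncation R v : ℝ) ^ 2) ∂μ ≤ 2 * R * postedRevenue μ := by
  have hlayer := lintegral_rpow_eq_lintegral_meas_le_mul μ
    (Filter.Eventually.of_forall fun v => (truncation R v).coe_nonneg)
    (measurable_truncation R).coe_nnreal_real.aemeasurable (p := 2) two_pos
  simp only [Real.rpow_two, ENNReal.ofReal_ofNat] at hlayer
  rw [hlayer, mul_assoc]
  gcongr
  calc ∫⁻ t in Set.Ioi (0 : ℝ), μ {v | t ≤ truncation R v} * ENNReal.ofReal (t ^ (2 - 1 : ℝ))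
      ≤ ∫⁻ t in Set.Ioi (0 : ℝ), (Set.Iio (R : ℝ)).indicator (fun _ => postedRevenue μ) t := by
        refine setLIntegral_mono (measurable_const.indicator measurableSet_Iio) fun t ht => ?_
        norm_num
        exact measure_le_truncation_mul_le μ R ht
    _ = R * postedRevenue μ := by
        rw [lintegral_indicator_const measurableSet_Iio, Measure.restrict_apply measurableSet_Iio,
          Set.inter_comm, Set.Ioi_inter_Iio, Real.volume_Ioo, sub_zero, ENNReal.ofReal_coe_nnreal,
          mul_comm]

theorem memLp_truncation (μ : Measure ℝ≥0) [IsFiniteMeasure μ] (R : ℝ≥0) {q : ℝ≥0∞} :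
    MemLp (fun v => (truncation R v : ℝ)) q μ :=
  MemLp.of_bound (measurable_truncation R).coe_nnreal_real.aestronglyMeasurable R
    (Filter.Eventually.of_forall fun v => by
      rw [Real.norm_of_nonneg (NNReal.coe_nonneg _)]
      exact NNReal.coe_le_coe.2 (truncation_le_threshold R v))

theorem ofReal_variance_truncation_le (μ : Measure ℝ≥0) [IsProbabilityMeasure μ] (R : ℝ≥0) :
    ENNReal.ofReal Var[fun v => (truncation R v : ℝ); μ] ≤ 2 * R * postedRevenue μ := by
  refine le_trans ?_ (lintegral_sq_truncation_le μ R)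
  rw [← ofReal_integral_eq_lintegral_ofReal (memLp_truncation μ R).integrable_sq
    (Filter.Eventually.of_forall fun v => sq_nonneg _)]
  exact ENNReal.ofReal_le_ofReal (variance_le_expectation_sq
    (measurable_truncation R).coe_nnreal_real.aestronglyMeasurable)

end

noncomputable section

/-! ### Selling to one additive bidder with independent values -/

/-- The values for which good `j` is a favorite. -/
def favoring {ι : Type*} (j : ι) : Set (ι → ℝ≥0) := {v | ∀ l, v l ≤ v j}

/-- The value of good `l` if another good has at least the same value, and `0` otherwise. -/
def outshone {ι : Type*} (l : ι) (v : ι → ℝ≥0) : ℝ≥0∞ :=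
  {v : ι → ℝ≥0 | ∃ j ≠ l, v l ≤ v j}.indicator (fun v => (v l : ℝ≥0∞)) v

/-- The value of good `l` if it is at least `R` but no more than the value of good `j`, and `0`
otherwise. -/
def tail {ι : Type*} (R : ℝ≥0) (l j : ι) (v : ι → ℝ≥0) : ℝ≥0∞ :=
  {v : ι → ℝ≥0 | R ≤ v l ∧ v l ≤ v j}.indicator (fun v => (v l : ℝ≥0∞)) v

/-- A truthful mechanism for one additive bidder: on reported values `v`, the bidder receives good
`i` with probability `x v i` and pays `p v`. -/
structure IsTruthfulOneBidder {ι : Type*} [Fintype ι] (x : (ι → ℝ≥0) → ι → ℝ)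
    (p : (ι → ℝ≥0) → ℝ) : Prop where
  alloc_nonneg : ∀ v i, 0 ≤ x v i
  alloc_le_one : ∀ v i, x v i ≤ 1
  incentive_compatible : ∀ v w : ι → ℝ≥0, ∑ i, v i * x w i - p w ≤ ∑ i, v i * x v i - p v
  individually_rational : ∀ v : ι → ℝ≥0, 0 ≤ ∑ i, v i * x v i - p v

section

variable {ι : Type*}

theorem measurableSet_favoring [Countable ι] (j : ι) : MeasurableSet (favoring j) := by
  unfold favoring
  measurability

@[fun_prop]
theorem measurable_tail (R : ℝ≥0) (l j : ι) : Measurable (tail R l j) := by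
  have hR : MeasurableSet {v : ι → ℝ≥0 | R ≤ v l} :=
    measurableSet_le measurable_const (measurable_pi_apply l)
  have hj : MeasurableSet {v : ι → ℝ≥0 | v l ≤ v j} :=
    measurableSet_le (measurable_pi_apply l) (measurable_pi_apply j)
  exact (measurable_pi_apply l).coe_nnreal_ennreal.indicator (hR.inter hj)

theorem outshone_le [Fintype ι] [DecidableEq ι] (R : ℝ≥0) (l : ι) (v : ι → ℝ≥0) :
    outshone l v ≤ ∑ j ∈ univ.erase l, tail R l j v + truncation R (v l) := by
  by_cases hout : ∃ j ≠ l, v l ≤ v j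
  swap
  · simp [outshone, hout]
  refine (Set.indicator_le_self _ _ v).trans ?_
  rcases lt_or_ge (v l) R with hR | hR
  · rw [truncation, if_pos hR]
    exact le_add_self
  · obtain ⟨j, hj, hlj⟩ := hout
    calc (v l : ℝ≥0∞) = tail R l j v := by simp [tail, hR, hlj]
      _ ≤ ∑ j ∈ univ.erase l, tail R l j v :=
        single_le_sum (f := fun j => tail R l j v) (fun _ _ => zero_le)
          (mem_erase.2 ⟨hj, mem_univ j⟩)
      _ ≤ _ := le_self_add

end

section

variable {ι : Type*} [Fintype ι] [DecidableEq ι] {x : (ι → ℝ≥0) → ι → ℝ} {p : (ι → ℝ≥0) → ℝ}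

/-- What is left of the payment after subtracting the values received from the goods other than
`j`. -/
def marginalPay (x : (ι → ℝ≥0) → ι → ℝ) (p : (ι → ℝ≥0) → ℝ) (j : ι) (v : ι → ℝ≥0) : ℝ :=
  p v - ∑ l ∈ univ.erase j, v l * x v l

@[fun_prop]
theorem measurable_marginalPay (hx : Measurable x) (hp : Measurable p) (j : ι) :
    Measurable (marginalPay x p j) := by
  unfold marginalPay
  fun_prop

theorem update_mem_favoring_iff (j : ι) (v : ι → ℝ≥0) (t : ℝ≥0) :
    Function.update v j t ∈ favoring j ↔ (univ.erase j).sup v ≤ t := by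
  simp only [favoring, Set.mem_ofPred_eq, Function.update_self, Finset.sup_le_iff, mem_erase,
    mem_univ, and_true]
  refine ⟨fun hfav l hl => by simpa [Function.update_of_ne hl] using hfav l, fun hsup l => ?_⟩
  rcases eq_or_ne l j with rfl | hl
  · simp
  · simpa [Function.update_of_ne hl] using hsup l hl

namespace IsTruthfulOneBidder

theorem ofReal_pay_le (H : IsTruthfulOneBidder x p) (v : ι → ℝ≥0) :
    ENNReal.ofReal (p v) ≤
      ∑ j, (favoring j).indicator (fun v => ENNReal.ofReal (marginalPay x p j v)) v +
        ∑ l, outshone l v := by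
  rcases isEmpty_or_nonempty ι
  · simpa using H.individually_rational v
  obtain ⟨j, hj⟩ := Finite.exists_max v
  have hp : p v = marginalPay x p j v + ∑ l ∈ univ.erase j, v l * x v l := by
    simp [marginalPay]
  rw [hp]
  refine ENNReal.ofReal_add_le.trans (add_le_add ?_ ?_)
  · rw [← Set.indicator_of_mem (s := favoring j) (a := v) hj
      fun v => ENNReal.ofReal (marginalPay x p j v)]
    exact single_le_sum (f := fun j => (favoring j).indicator
      (fun v => ENNReal.ofReal (marginalPay x p j v)) v) (fun _ _ => zero_le) (mem_univ j)
  · rw [ENNReal.ofReal_sum_of_nonneg fun l _ =>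
      mul_nonneg (v l).coe_nonneg (H.alloc_nonneg v l)]
    refine (sum_le_sum fun l hl => ?_).trans (sum_le_sum_of_subset (erase_subset j univ))
    have hout : v ∈ {v : ι → ℝ≥0 | ∃ j ≠ l, v l ≤ v j} := ⟨j, (ne_of_mem_erase hl).symm, hj l⟩
    rw [outshone, Set.indicator_of_mem hout]
    exact (ENNReal.ofReal_le_ofReal
      (mul_le_of_le_one_right (v l).coe_nonneg (H.alloc_le_one v l))).trans_eq
        ENNReal.ofReal_coe_nnreal

theorem oneGood_update (H : IsTruthfulOneBidder x p) (j : ι) (v : ι → ℝ≥0) :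
    IsTruthfulOneGood (fun t => x (Function.update v j t) j)
      (fun t => marginalPay x p j (Function.update v j t)) := by
  have hsplit : ∀ (t : ℝ≥0) (y : ι → ℝ), ∑ l, (Function.update v j t l : ℝ) * y l =
      t * y j + ∑ l ∈ univ.erase j, (v l : ℝ) * y l := fun t y => by
    rw [← add_sum_erase _ _ (mem_univ j), Function.update_self]
    congr 1
    exact sum_congr rfl fun l hl => by rw [Function.update_of_ne (ne_of_mem_erase hl)]
  have hmarginal : ∀ t : ℝ≥0, marginalPay x p j (Function.update v j t) =
      p (Function.update v j t) - ∑ l ∈ univ.erase j, (v l : ℝ) * x (Function.update v j t) l :=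
    fun t => congrArg (p _ - ·) <|
      sum_congr rfl fun l hl => by rw [Function.update_of_ne (ne_of_mem_erase hl)]
  refine ⟨fun t => H.alloc_nonneg _ j, fun t => H.alloc_le_one _ j, fun t s => ?_, fun t => ?_⟩
  · have hic := H.incentive_compatible (Function.update v j t) (Function.update v j s)
    rw [hsplit, hsplit] at hic
    rw [hmarginal, hmarginal]
    linarith
  · have hir := H.individually_rational (Function.update v j t)
    rw [hsplit] at hir
    rw [hmarginal]
    linarith

end IsTruthfulOneBidder

end

section

variable {ι : Type*} [Fintype ι] {μ : ι → Measure ℝ≥0} [∀ j, IsProbabilityMeasure (μ j)]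
  {x : (ι → ℝ≥0) → ι → ℝ} {p : (ι → ℝ≥0) → ℝ}

theorem lintegral_pi_le_of_update [DecidableEq ι] {f g : (ι → ℝ≥0) → ℝ≥0∞} (hf : Measurable f)
    (hg : Measurable g) (j : ι) (hgj : ∀ v t, g (Function.update v j t) = g v)
    (h : ∀ v, ∫⁻ t, f (Function.update v j t) ∂μ j ≤ g v) :
    ∫⁻ v, f v ∂Measure.pi μ ≤ ∫⁻ v, g v ∂Measure.pi μ := by
  refine lintegral_le_of_lmarginal_le {j} hf hg ?_
  rw [lmarginal_singleton, lmarginal_singleton]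
  intro v
  simpa [hgj] using h v

theorem IsTruthfulOneBidder.lintegral_marginalPay_le [DecidableEq ι]
    (H : IsTruthfulOneBidder x p) (hx : Measurable x) (hp : Measurable p) (j : ι) :
    ∫⁻ v in favoring j, ENNReal.ofReal (marginalPay x p j v) ∂Measure.pi μ ≤
      postedRevenue (μ j) := by
  rw [← lintegral_indicator (measurableSet_favoring j)]
  refine (lintegral_pi_le_of_update (g := fun _ => postedRevenue (μ j))
    ((measurable_marginalPay hx hp j).ennreal_ofReal.indicator (measurableSet_favoring j))
    measurable_const j (fun _ _ => rfl) fun v => ?_).trans (by simp)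
  refine le_of_eq_of_le ?_
    ((H.oneGood_update j v).setLIntegral_pay_le (μ j) ((univ.erase j).sup v))
  rw [← lintegral_indicator measurableSet_Ici]
  classical
  refine lintegral_congr fun t => ?_
  simp only [Set.indicator_apply, update_mem_favoring_iff, Set.mem_Ici]

theorem lintegral_tail_le {l j : ι} (hlj : l ≠ j) (R : ℝ≥0) :
    ∫⁻ v, tail R l j v ∂Measure.pi μ ≤ postedRevenue (μ j) * μ l (Set.Ici R) := by
  classical
  have hset : MeasurableSet {v : ι → ℝ≥0 | R ≤ v l} :=
    measurableSet_le measurable_const (measurable_pi_apply l)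
  calc ∫⁻ v, tail R l j v ∂Measure.pi μ
      ≤ ∫⁻ v, {v : ι → ℝ≥0 | R ≤ v l}.indicator (fun _ => postedRevenue (μ j)) v
          ∂Measure.pi μ := by
        refine lintegral_pi_le_of_update (measurable_tail R l j) (measurable_const.indicator hset)
          j (fun v t => by simp [Set.indicator_apply, Function.update_of_ne hlj]) fun v => ?_
        by_cases hv : R ≤ v l
        swap
        · simp [tail, Function.update_of_ne hlj, hv]
        have htail : ∀ t, tail R l j (Function.update v j t) =
            (Set.Ici (v l)).indicator (fun _ => (v l : ℝ≥0∞)) t := fun t => by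
          simp [tail, Set.indicator_apply, Function.update_of_ne hlj, hv]
        simp only [htail]
        simpa [lintegral_indicator_const measurableSet_Ici, hv] using
          mul_measure_Ici_le_postedRevenue (μ j) (v l)
    _ = postedRevenue (μ j) * μ l (Set.Ici R) := by
        rw [lintegral_indicator_const hset,
          ← (measurePreserving_eval μ l).measure_preimage measurableSet_Ici.nullMeasurableSet]
        rfl

theorem lintegral_sum_outshone_le {R : ℝ≥0} (hR : ∑ j, postedRevenue (μ j) ≤ R) :
    ∫⁻ v, ∑ l, outshone l v ∂Measure.pi μ ≤ ∑ l, postedRevenue (μ l) +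
      ∫⁻ v, ∑ l, (truncation R (v l) : ℝ≥0∞) ∂Measure.pi μ := by
  classical
  have htail : Measurable fun v : ι → ℝ≥0 => ∑ l, ∑ j ∈ univ.erase l, tail R l j v := by fun_prop
  calc ∫⁻ v, ∑ l, outshone l v ∂Measure.pi μ
      ≤ ∫⁻ v, (∑ l, ∑ j ∈ univ.erase l, tail R l j v + ∑ l, (truncation R (v l) : ℝ≥0∞))
          ∂Measure.pi μ := lintegral_mono fun v => by
        rw [← sum_add_distrib]
        exact sum_le_sum fun l _ => outshone_le R l v
    _ = ∑ l, ∑ j ∈ univ.erase l, ∫⁻ v, tail R l j v ∂Measure.pi μ +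
          ∫⁻ v, ∑ l, (truncation R (v l) : ℝ≥0∞) ∂Measure.pi μ := by
        rw [lintegral_add_left htail, lintegral_finsetSum _ fun l _ => by fun_prop]
        congr 1
        exact sum_congr rfl fun l _ => lintegral_finsetSum _ fun j _ => measurable_tail R l j
    _ ≤ ∑ l, R * μ l (Set.Ici R) + ∫⁻ v, ∑ l, (truncation R (v l) : ℝ≥0∞) ∂Measure.pi μ := by
        gcongr with l
        calc ∑ j ∈ univ.erase l, ∫⁻ v, tail R l j v ∂Measure.pi μ
            ≤ ∑ j ∈ univ.erase l, postedRevenue (μ j) * μ l (Set.Ici R) :=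
              sum_le_sum fun j hj => lintegral_tail_le (ne_of_mem_erase hj).symm R
          _ ≤ ∑ j, postedRevenue (μ j) * μ l (Set.Ici R) :=
              sum_le_sum_of_subset (erase_subset l univ)
          _ ≤ R * μ l (Set.Ici R) := by
              rw [← sum_mul]
              gcongr
    _ ≤ _ := by
        gcongr with l
        exact mul_measure_Ici_le_postedRevenue (μ l) R

theorem variance_sum_truncation_le {R : ℝ≥0} (hR : ∑ j, postedRevenue (μ j) ≤ R) :
    Var[fun v => ∑ l, (truncation R (v l) : ℝ); Measure.pi μ] ≤ 2 * (R : ℝ) ^ 2 := by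
  have hsum := variance_sum_pi fun j => memLp_truncation (μ j) R
  rw [Finset.sum_fn] at hsum
  rw [hsum, ← ENNReal.ofReal_le_ofReal_iff (by positivity),
    ENNReal.ofReal_sum_of_nonneg fun j _ => variance_nonneg _ _]
  calc ∑ j, ENNReal.ofReal Var[fun v => (truncation R v : ℝ); μ j]
      ≤ ∑ j, 2 * R * postedRevenue (μ j) :=
        sum_le_sum fun j _ => ofReal_variance_truncation_le (μ j) R
    _ ≤ 2 * R * R := by
        rw [← mul_sum]
        gcongr
    _ = ENNReal.ofReal (2 * (R : ℝ) ^ 2) := by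
        rw [sq, ← mul_assoc, ENNReal.ofReal_mul (by positivity), ENNReal.ofReal_mul two_pos.le,
          ENNReal.ofReal_coe_nnreal, ENNReal.ofReal_ofNat]

/-- By Chebyshev's inequality, `E[X] - 2R` is a price that `Y ≥ X` meets with probability at least
`1/2`. -/
theorem ofReal_integral_le_postedRevenue_of_variance_le {Ω : Type*} [MeasurableSpace Ω]
    {P : Measure Ω} [IsProbabilityMeasure P] {X : Ω → ℝ} {Y : Ω → ℝ≥0} (hX : MemLp X 2 P)
    (hY : Measurable Y) (hXY : ∀ ω, X ω ≤ Y ω) {R : ℝ≥0} (hR : 0 < R)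
    (hvar : Var[X; P] ≤ 2 * (R : ℝ) ^ 2) :
    ENNReal.ofReal (∫ ω, X ω ∂P) ≤ 2 * postedRevenue (P.map Y) + 2 * R := by
  set c := ∫ ω, X ω ∂P
  have hdev : P {ω | 2 * (R : ℝ) ≤ |X ω - c|} ≤ 2⁻¹ := by
    refine (meas_ge_le_variance_div_sq hX (by positivity)).trans ?_
    rw [← ENNReal.ofReal_ofNat 2, ← ENNReal.ofReal_inv_of_pos two_pos]
    refine ENNReal.ofReal_le_ofReal ?_
    rw [div_le_iff₀ (by positivity)]
    linarith
  set y : ℝ≥0 := (c - 2 * R).toNNReal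
  have hcover : Set.univ ⊆ {ω | 2 * (R : ℝ) ≤ |X ω - c|} ∪ Y ⁻¹' Set.Ici y := fun ω _ => by
    refine (le_or_gt (2 * (R : ℝ)) |X ω - c|).imp_right fun hω => ?_
    rw [Set.mem_preimage, Set.mem_Ici, Real.toNNReal_le_iff_le_coe]
    linarith [(abs_lt.1 hω).1, hXY ω]
  have hhalf : 2⁻¹ ≤ P.map Y (Set.Ici y) := by
    rw [Measure.map_apply hY measurableSet_Ici]
    have htotal : 2⁻¹ + 2⁻¹ ≤ 2⁻¹ + P (Y ⁻¹' Set.Ici y) := by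
      rw [ENNReal.inv_two_add_inv_two, ← measure_univ (μ := P)]
      exact (measure_mono hcover).trans ((measure_union_le _ _).trans (by gcongr))
    exact (ENNReal.add_le_add_iff_left (by simp)).1 htotal
  calc ENNReal.ofReal c ≤ ENNReal.ofReal (c - 2 * R) + ENNReal.ofReal (2 * R) := by
        simpa using ENNReal.ofReal_add_le (p := c - 2 * R) (q := 2 * R)
    _ = 2 * (y * 2⁻¹) + 2 * R := by
        rw [mul_left_comm, ENNReal.mul_inv_cancel two_ne_zero ENNReal.ofNat_ne_top, mul_one,
          ENNReal.ofReal_mul two_pos.le, ENNReal.ofReal_coe_nnreal, ENNReal.ofReal_ofNat]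
        rfl
    _ ≤ 2 * postedRevenue (P.map Y) + 2 * R := by
        gcongr
        exact le_trans (by gcongr) (mul_measure_Ici_le_postedRevenue (P.map Y) y)

theorem lintegral_sum_truncation_le {R : ℝ≥0} (hR : ∑ j, postedRevenue (μ j) ≤ R) :
    ∫⁻ v, ∑ l, (truncation R (v l) : ℝ≥0∞) ∂Measure.pi μ ≤
      2 * postedRevenue ((Measure.pi μ).map fun v => ∑ l, v l) + 2 * R := by
  rcases eq_zero_or_pos R with rfl | hRpos
  · simp [truncation]
  have hLp : MemLp (fun v : ι → ℝ≥0 => ∑ l, (truncation R (v l) : ℝ)) 2 (Measure.pi μ) :=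
    memLp_finsetSum _ fun l _ =>
      (memLp_truncation (μ l) R).comp_measurePreserving (measurePreserving_eval μ l)
  have hle : ∀ v : ι → ℝ≥0, ∑ l, (truncation R (v l) : ℝ) ≤ (∑ l, v l : ℝ≥0) := fun v => by
    exact_mod_cast sum_le_sum fun l _ => truncation_le_self R (v l)
  refine le_of_eq_of_le ?_ (ofReal_integral_le_postedRevenue_of_variance_le hLp (by fun_prop) hle
    hRpos (variance_sum_truncation_le hR))
  rw [ofReal_integral_eq_lintegral_ofReal (hLp.integrable one_le_two)
    (Filter.Eventually.of_forall fun v => by positivity)]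
  refine lintegral_congr fun v => ?_
  rw [← NNReal.coe_sum, ENNReal.ofReal_coe_nnreal, ENNReal.ofNNReal_finsetSum]

theorem IsTruthfulOneBidder.lintegral_pay_le (H : IsTruthfulOneBidder x p)
    (hx : Measurable x) (hp : Measurable p) :
    ∫⁻ v, ENNReal.ofReal (p v) ∂Measure.pi μ ≤ 4 * ∑ j, postedRevenue (μ j) +
      2 * postedRevenue ((Measure.pi μ).map fun v => ∑ l, v l) := by
  classical
  rcases eq_or_ne (∑ j, postedRevenue (μ j)) ⊤ with htop | htop
  · simp [htop]
  lift ∑ j, postedRevenue (μ j) to ℝ≥0 using htop with R hR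
  have hmarginal : ∀ j, Measurable fun v =>
      (favoring j).indicator (fun v => ENNReal.ofReal (marginalPay x p j v)) v := fun j =>
    (measurable_marginalPay hx hp j).ennreal_ofReal.indicator (measurableSet_favoring j)
  calc ∫⁻ v, ENNReal.ofReal (p v) ∂Measure.pi μ
      ≤ ∑ j, ∫⁻ v in favoring j, ENNReal.ofReal (marginalPay x p j v) ∂Measure.pi μ +
          ∫⁻ v, ∑ l, outshone l v ∂Measure.pi μ := by
        refine (lintegral_mono H.ofReal_pay_le).trans_eq ?_
        rw [lintegral_add_left (Finset.measurable_fun_sum _ fun j _ => hmarginal j),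
          lintegral_finsetSum _ fun j _ => hmarginal j]
        simp only [lintegral_indicator (measurableSet_favoring _)]
    _ ≤ R + (R + (2 * postedRevenue ((Measure.pi μ).map fun v => ∑ l, v l) + 2 * R)) := by
        have houtshone := lintegral_sum_outshone_le hR.ge
        rw [← hR] at houtshone
        gcongr
        · exact hR ▸ sum_le_sum fun j _ => H.lintegral_marginalPay_le hx hp j
        · exact houtshone.trans (by gcongr; exact lintegral_sum_truncation_le hR.ge)
    _ = 4 * R + 2 * postedRevenue ((Measure.pi μ).map fun v => ∑ l, v l) := by ring

end

end

noncomputable section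

/-! ### Best-of-both pricing against all truthful mechanisms -/

variable {k m : ℕ} {rule : SaleRule} {A : AuctionClass 1 k}

/-- With one bidder, the class contains all item prices and all grand-bundle prices. -/
structure AuctionClass.ContainsBest (A : AuctionClass 1 k) : Prop where
  item : ∀ q : Fin k → ℝ≥0, ∃ h, ∀ v, (A.mech h).revenue v =
    ∑ j, ((if q j ≤ v 0 j then q j else 0 : ℝ≥0) : ℝ)
  bundle : ∀ y : ℝ≥0, ∃ h, ∀ v, (A.mech h).revenue v =
    (if y ≤ ∑ j, v 0 j then y else 0 : ℝ≥0)

theorem bundleMechanism_revenue_one (rule : SaleRule) (q : Fin 1 → ℝ≥0) (v : Profile 1 k) :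
    (bundleMechanism rule q).revenue v = (if q 0 ≤ ∑ j, v 0 j then q 0 else 0 : ℝ≥0) := by
  rw [bundleMechanism_revenue, goodRevenue_one]
  rfl

theorem itemMechanism_revenue_one (rule : SaleRule) (q : Fin 1 → Fin k → ℝ≥0) (v : Profile 1 k) :
    (itemMechanism rule q).revenue v =
      ∑ j, ((if q 0 j ≤ v 0 j then q 0 j else 0 : ℝ≥0) : ℝ) := by
  simp only [itemMechanism_revenue, goodRevenue_one]
  rfl

theorem containsBest_anonymousBestPricing : (anonymousBestPricing rule 1 k).ContainsBest where
  item q := ⟨Sum.inr q, itemMechanism_revenue_one rule fun _ => q⟩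
  bundle y := ⟨Sum.inl y, bundleMechanism_revenue_one rule fun _ => y⟩

theorem containsBest_bestPricing : (bestPricing rule 1 k).ContainsBest where
  item q := ⟨Sum.inr fun _ => q, itemMechanism_revenue_one rule fun _ => q⟩
  bundle y := ⟨Sum.inl fun _ => y, bundleMechanism_revenue_one rule fun _ => y⟩

theorem lintegral_ite_le_eq_mul_map_Ici {Ω : Type*} [MeasurableSpace Ω] {D : Measure Ω}
    {f : Ω → ℝ≥0} (hf : Measurable f) (y : ℝ≥0) :
    ∫⁻ v, ((if y ≤ f v then y else 0 : ℝ≥0) : ℝ≥0∞) ∂D = y * D.map f (Set.Ici y) := by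
  rw [← lintegral_indicator_const measurableSet_Ici, lintegral_map (by measurability) hf]
  simp only [Set.indicator_apply, Set.mem_Ici, apply_ite ENNReal.ofNNReal, ENNReal.coe_zero]

theorem sum_iSup_le_of_forall_sum_le {ι α : Type*} [Fintype ι] {g : ι → α → ℝ≥0∞} {c : ℝ≥0∞}
    (h : ∀ q : ι → α, ∑ j, g j (q j) ≤ c) : ∑ j, ⨆ y, g j y ≤ c := by
  classical
  rcases isEmpty_or_nonempty α
  · simp
  have hsurj (j : ι) : Function.Surjective fun q : ι → α => q j := fun y => ⟨fun _ => y, rfl⟩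
  simp only [← fun j => (hsurj j).iSup_comp (g j)]
  rw [ENNReal.finsetSum_iSup]
  · exact iSup_le h
  · intro q q'
    refine ⟨fun j => if g j (q j) ≤ g j (q' j) then q' j else q j, fun j => ?_⟩
    grind

theorem Mechanism.IsTruthful.isTruthfulOneBidder {M : Mechanism 1 k} (hM : M.IsTruthful) :
    IsTruthfulOneBidder (fun w => M.alloc (fun _ => w) 0) fun w => M.pay (fun _ => w) 0 where
  alloc_nonneg _ _ := hM.alloc_nonneg _ _ _
  alloc_le_one w j := by simpa using hM.alloc_le_one (fun _ => w) j
  incentive_compatible v w := by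
    have hdeviate : Function.update (fun _ : Fin 1 => v) 0 w = fun _ => w :=
      funext fun i => by rw [Subsingleton.elim i 0, Function.update_self]
    simpa only [Mechanism.utility, hdeviate] using hM.incentive_compatible (fun _ => v) 0 w
  individually_rational v := hM.individually_rational (fun _ => v) 0

theorem Mechanism.expRevenue_eq_integral_map {M : Mechanism 1 k} (hpay : Measurable M.pay)
    (D : Measure (Profile 1 k)) :
    M.expRevenue D = ∫ w, M.pay (fun _ => w) 0 ∂D.map fun v => v 0 := by
  have hpay0 : Measurable fun w : Fin k → ℝ≥0 => M.pay (fun _ => w) 0 := by fun_prop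
  rw [integral_map (measurable_pi_apply 0).aemeasurable hpay0.aestronglyMeasurable,
    Mechanism.expRevenue]
  refine integral_congr_ae (.of_forall fun v => ?_)
  have hv : (fun _ => v 0) = v := funext fun i => by rw [Subsingleton.elim i 0]
  simp only [Mechanism.revenue, Fin.sum_univ_one, hv]

theorem integral_le_of_lintegral_ofReal_le {Ω : Type*} [MeasurableSpace Ω] {D : Measure Ω}
    {f : Ω → ℝ} {c : ℝ} (hc : 0 ≤ c) (h : ∫⁻ v, ENNReal.ofReal (f v) ∂D ≤ ENNReal.ofReal c) :
    ∫ v, f v ∂D ≤ c := by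
  by_cases hf : Integrable f D
  · rw [integral_eq_lintegral_pos_part_sub_lintegral_neg_part hf]
    exact (sub_le_self _ ENNReal.toReal_nonneg).trans (ENNReal.toReal_le_of_le_ofReal hc h)
  · rwa [integral_undef hf]

theorem AuctionClass.IsTame.lintegral_ofReal_revenue_le_optRevenue {n : ℕ} {A : AuctionClass n k}
    (hA : A.IsTame) {D : ProbabilityMeasure (Profile n k)} (hD : D ∈ A.unitRevenue) (h : A.Hyp) :
    ∫⁻ v, ENNReal.ofReal ((A.mech h).revenue v) ∂(D : Measure (Profile n k)) ≤
      ENNReal.ofReal (A.optRevenue D) := by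
  have hunit : ∀ᵐ v ∂(D : Measure (Profile n k)), A.UnitRevenueAt v := hD
  have hbdd : BddAbove (Set.range fun h => (A.mech h).expRevenue (D : Measure (Profile n k))) :=
    ⟨1, Set.forall_mem_range.2 fun h => (A.expRevenue_mem_Icc hunit h).2⟩
  rw [← ofReal_integral_eq_lintegral_ofReal (hA.integrable_revenue hunit h)
    (hunit.mono fun v hv => (hv h).1)]
  exact ENNReal.ofReal_le_ofReal (le_ciSup hbdd h)

namespace AuctionClass.ContainsBest

variable {D : ProbabilityMeasure (Profile 1 k)} (hD : D ∈ A.unitRevenue)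
include hD

theorem postedRevenue_bundle_le (hA : A.ContainsBest) (hT : A.IsTame) :
    postedRevenue ((D : Measure (Profile 1 k)).map fun v => ∑ j, v 0 j) ≤
      ENNReal.ofReal (A.optRevenue D) := by
  refine iSup_le fun y => ?_
  obtain ⟨h, hh⟩ := hA.bundle y
  rw [← lintegral_ite_le_eq_mul_map_Ici (by fun_prop)]
  simpa only [hh, ENNReal.ofReal_coe_nnreal] using hT.lintegral_ofReal_revenue_le_optRevenue hD h

theorem sum_postedRevenue_item_le (hA : A.ContainsBest) (hT : A.IsTame) :
    ∑ j, postedRevenue ((D : Measure (Profile 1 k)).map fun v => v 0 j) ≤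
      ENNReal.ofReal (A.optRevenue D) := by
  refine sum_iSup_le_of_forall_sum_le fun q => ?_
  obtain ⟨h, hh⟩ := hA.item q
  calc ∑ j, q j * ((D : Measure (Profile 1 k)).map fun v => v 0 j) (Set.Ici (q j))
      = ∑ j, ∫⁻ v, ((if q j ≤ v 0 j then q j else 0 : ℝ≥0) : ℝ≥0∞) ∂(D : Measure (Profile 1 k)) :=
        Finset.sum_congr rfl fun j _ => (lintegral_ite_le_eq_mul_map_Ici (by fun_prop) _).symm
    _ = ∫⁻ v, ENNReal.ofReal ((A.mech h).revenue v) ∂(D : Measure (Profile 1 k)) := by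
        rw [← lintegral_finsetSum _ fun j _ => by
          exact (Measurable.ite (measurableSet_le measurable_const (by fun_prop))
            measurable_const measurable_const).coe_nnreal_ennreal]
        simp only [hh, ← NNReal.coe_sum, ENNReal.ofReal_coe_nnreal, ENNReal.ofNNReal_finsetSum]
    _ ≤ ENNReal.ofReal (A.optRevenue D) := hT.lintegral_ofReal_revenue_le_optRevenue hD h

theorem expRevenue_le (hA : A.ContainsBest) (hT : A.IsTame)
    (hind : iIndepFun (fun (j : Fin k) (v : Profile 1 k) => v 0 j) (D : Measure (Profile 1 k)))
    {M : Mechanism 1 k} (hM : M.IsTruthful) (halloc : Measurable M.alloc)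
    (hpay : Measurable M.pay) : M.expRevenue D ≤ 6 * A.optRevenue D := by
  let μ (j : Fin k) : Measure ℝ≥0 := (D : Measure (Profile 1 k)).map fun v => v 0 j
  have hval (j : Fin k) : Measurable fun v : Profile 1 k => v 0 j := by fun_prop
  have hprob (j : Fin k) : IsProbabilityMeasure (μ j) :=
    Measure.isProbabilityMeasure_map (hval j).aemeasurable
  have hpi : (D : Measure (Profile 1 k)).map (fun v => v 0) = Measure.pi μ :=
    hind.map_fun_eq_pi_map fun j => (hval j).aemeasurable
  have hsum : (Measure.pi μ).map (fun v => ∑ j, v j) =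
      (D : Measure (Profile 1 k)).map fun v => ∑ j, v 0 j := by
    rw [← hpi, Measure.map_map (by fun_prop) (by fun_prop)]
    rfl
  have hopt : 0 ≤ A.optRevenue D :=
    Real.iSup_nonneg fun h => (A.expRevenue_mem_Icc hD h).1
  rw [Mechanism.expRevenue_eq_integral_map hpay, hpi]
  refine integral_le_of_lintegral_ofReal_le (by positivity) ?_
  calc ∫⁻ w, ENNReal.ofReal (M.pay (fun _ => w) 0) ∂Measure.pi μ
      ≤ 4 * ∑ j, postedRevenue (μ j) +
          2 * postedRevenue ((Measure.pi μ).map fun v => ∑ j, v j) :=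
        hM.isTruthfulOneBidder.lintegral_pay_le (by fun_prop) (by fun_prop)
    _ ≤ 4 * ENNReal.ofReal (A.optRevenue D) + 2 * ENNReal.ofReal (A.optRevenue D) := by
        rw [hsum]
        gcongr
        · exact hA.sum_postedRevenue_item_le hD hT
        · exact hA.postedRevenue_bundle_le hD hT
    _ = ENNReal.ofReal (6 * A.optRevenue D) := by
        rw [← add_mul, ENNReal.ofReal_mul (by norm_num)]
        norm_num

theorem ofReal_sixth_expRevenue_le (hA : A.ContainsBest) (hT : A.IsTame)
    (hcard : ∀ S : Multiset (Profile 1 k), S.card = 2 * m →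
      (A.onSample S).encard ≤ ((2 * m) ^ (k + 1) : ℕ))
    {erm : Multiset (Profile 1 k) → A.Hyp} (herm : A.IsERM erm) (hm : 0 < m)
    (hind : iIndepFun (fun (j : Fin k) (v : Profile 1 k) => v 0 j) (D : Measure (Profile 1 k)))
    {M : Mechanism 1 k} (hM : M.IsTruthful) (halloc : Measurable M.alloc)
    (hpay : Measurable M.pay) :
    ENNReal.ofReal (1 / 6 * M.expRevenue D) ≤ A.learnedRevenue erm D m +
      ENNReal.ofReal √(2 * (k + 1) * Real.log (2 * m) / m) := by
  have htwo : 2 ≤ (2 * m) ^ (k + 1) :=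
    (Nat.le_mul_of_pos_right 2 hm).trans (Nat.le_self_pow k.succ_ne_zero _)
  have hlog : 2 * Real.log ((2 * m) ^ (k + 1) : ℕ) = 2 * (k + 1) * Real.log (2 * m) := by
    push_cast [Real.log_pow]
    ring
  have hbench := hA.expRevenue_le hD hT hind hM halloc hpay
  calc ENNReal.ofReal (1 / 6 * M.expRevenue D) ≤ ENNReal.ofReal (A.optRevenue D) :=
        ENNReal.ofReal_le_ofReal (by linarith)
    _ ≤ _ := hlog ▸ hT.optRevenue_le_of_splitDeviationLE herm hD hm
        (hT.splitDeviationLE_of_encard htwo hcard)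

end AuctionClass.ContainsBest

end

end SplitSample

open SplitSample in
theorem mainTheorem6 :
    -- ERM prices are sample values
    (∀ (rule : SaleRule) (n k : ℕ), 0 < n → 0 < k →
      (anonymousBundlePricing rule n k).ERMOnSample ∧
      (bundlePricing rule n k).ERMOnSample ∧
      (anonymousItemPricing rule n k).ERMOnSample ∧
      (itemPricing rule n k).ERMOnSample ∧
      (anonymousBestPricing rule n k).ERMOnSample ∧
      (bestPricing rule n k).ERMOnSample) ∧
    -- split-sample growth rates
    (∀ (rule : SaleRule) (n k m : ℕ), 0 < n → 0 < k → 0 < m →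
      (anonymousBundlePricing rule n k).GrowthLE m (m * n) ∧
      (bundlePricing rule n k).GrowthLE m (m ^ n) ∧
      (anonymousItemPricing rule n k).GrowthLE m ((n * m) ^ k) ∧
      (itemPricing rule n k).GrowthLE m (m ^ (n * k)) ∧
      (anonymousBestPricing rule n k).GrowthLE m ((m * n) ^ (k + 1)) ∧
      (bestPricing rule n k).GrowthLE m (m ^ (n * (k + 1)))) ∧
    -- sample complexity, with one constant for all numbers of bidders and items
    (∃ C : ℝ, 0 < C ∧ ∀ (rule : SaleRule) (n k : ℕ), 0 < n → 0 < k →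
      ∀ ε : ℝ, 0 < ε → ε ≤ 1 / 2 →
      (anonymousBundlePricing rule n k).ComplexityLE ε (C * (n * Real.log (1 / ε) / ε ^ 2)) ∧
      (bundlePricing rule n k).ComplexityLE ε (C * (n * Real.log (1 / ε) / ε ^ 2)) ∧
      (anonymousItemPricing rule n k).ComplexityLE ε (C * (n * k * Real.log (1 / ε) / ε ^ 2)) ∧
      (itemPricing rule n k).ComplexityLE ε (C * (n * k * Real.log (1 / ε) / ε ^ 2)) ∧
      (anonymousBestPricing rule n k).ComplexityLE ε
        (C * (n * (k + 1) * Real.log (1 / ε) / ε ^ 2)) ∧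
      (bestPricing rule n k).ComplexityLE ε (C * (n * (k + 1) * Real.log (1 / ε) / ε ^ 2))) ∧
    -- one bidder with independent item values: guarantee against all truthful mechanisms
    (∀ (rule : SaleRule) (k : ℕ), 0 < k →
      ∀ A ∈ ({anonymousBestPricing rule 1 k, bestPricing rule 1 k} : Set (AuctionClass 1 k)),
      ∀ erm, A.IsERM erm →
      ∀ D : ProbabilityMeasure (Profile 1 k), D ∈ A.unitRevenue →
      iIndepFun (fun (j : Fin k) (v : Profile 1 k) => v 0 j) (D : Measure (Profile 1 k)) →
      ∀ M : Mechanism 1 k, M.IsTruthful → Measurable M.alloc → Measurable M.pay →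
      ∀ m : ℕ, 0 < m →
        ENNReal.ofReal (1 / 6 * M.expRevenue D) ≤
          A.learnedRevenue erm D m +
            ENNReal.ofReal (Real.sqrt (2 * (k + 1) * Real.log (2 * m) / m))) := by
  refine ⟨fun rule n k hn _ => ?_, fun rule n k m hn hk hm => ?_,
    ⟨6000000, by norm_num, fun rule n k hn hk ε hε hε2 => ?_⟩,
    fun rule k hk A hA erm herm D hD hind M hM halloc hpay m hm => ?_⟩
  · have : NeZero n := ⟨hn.ne'⟩
    exact ⟨isTame_anonymousBundlePricing.ermOnSample, isTame_bundlePricing.ermOnSample,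
      isTame_anonymousItemPricing.ermOnSample, isTame_itemPricing.ermOnSample,
      isTame_anonymousBestPricing.ermOnSample, isTame_bestPricing.ermOnSample⟩
  · have : NeZero n := ⟨hn.ne'⟩
    exact ⟨growthLE_anonymousBundlePricing hm, growthLE_bundlePricing hm,
      growthLE_anonymousItemPricing hm, growthLE_itemPricing hm,
      growthLE_anonymousBestPricing hk hm, growthLE_bestPricing hn hk hm⟩
  · have : NeZero n := ⟨hn.ne'⟩
    exact ⟨complexityLE_anonymousBundlePricing hε hε2, complexityLE_bundlePricing hε hε2 hn,
      complexityLE_anonymousItemPricing hε hε2 hk, complexityLE_itemPricing hε hε2 hn hk,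
      complexityLE_anonymousBestPricing hε hε2, complexityLE_bestPricing hε hε2 hn⟩
  · rcases hA with rfl | rfl
    · refine containsBest_anonymousBestPricing.ofReal_sixth_expRevenue_le hD
        isTame_anonymousBestPricing (fun S hS => ?_) herm hm hind hM halloc hpay
      simpa [hS] using encard_onSample_anonymousBestPricing (rule := rule) (S := S) hk (by omega)
    · refine containsBest_bestPricing.ofReal_sixth_expRevenue_le hD
        isTame_bestPricing (fun S hS => ?_) herm hm hind hM halloc hpay
      simpa [hS] using encard_onSample_bestPricing (rule := rule) (S := S) one_pos hk (by omega)
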